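/- Let $p>3$ be a prime, $\mathbb Z_p$ the ring of $p$-adic integers, and let $F(a,b,c\,|\,z)=\sum_{n\ge0}\frac{(a)_n(b)_n}{(c)_n\,n!}z^n$ be the Gauss hypergeometric series, where $(a)_n=a(a+1)\cdots(a+n-1)$. Put $$Y(t)=\begin{pmatrix} F(\tfrac13,\tfrac23,\tfrac12\,|\,\tfrac{27t^2}4)& -\tfrac32\,t\,F(\tfrac76,\tfrac56,\tfrac32\,|\,\tfrac{27t^2}4)\\ -t\,F(\tfrac23,\tfrac43,\tfrac32\,|\,\tfrac{27t^2}4)& F(\tfrac16,\tfrac56,\tfrac12\,|\,\tfrac{27t^2}4) \end{pmatrix}.$$ For $n\ge 1$ let $Y(t)_n$ be the matrix obtained from $Y(t)$ by deleting in every entry all terms $t^k$ with $k\ge n$, and let $Y(t^p)_n$ be the result of substituting $t^p$ for $t$ in $Y(t)_n$. Then $Y(t)$ has entries in $\mathbb Z_p[[t]]$, the matrix $Y(t^p)$ is invertible over $\mathbb Z_p[[t]]$, and for all integers $m,s\ge1$ $$Y(t)_{mp^s}\equiv \bigl(Y(t)\,Y(t^p)^{-1}\bigr)\,Y(t^p)_{mp^{s-1}}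 \pmod{p^s},$$ where the congruence is entrywise modulo the ideal $p^s\,\mathbb Z_p[[t]]$ of $\mathbb Z_p[[t]]$. -/

import Mathlib

noncomputable section

namespace DworkMatrix

open PowerSeries

/-- The Gauss hypergeometric series `F(a, b, c | z) = ∑ (a)_n (b)_n / ((c)_n n!) z ^ n`,
as a formal power series in `z` over a field `K`. -/
def hyp {K : Type*} [Field K] (a b c : K) : K⟦X⟧ :=
  PowerSeries.mk (ordinaryHypergeometricCoefficient a b c)

/-- The power series `F(a, b, c | 27 t ^ 2 / 4)` in the variable `t`. -/
def hypT {K : Type*} [Field K] (a b c : K) : K⟦X⟧ :=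
  (hyp a b c).subst (C (27 / 4 : K) * X ^ 2 : K⟦X⟧)

/-- The `2 × 2` matrix `Y(t)` of hypergeometric power series over a field `K`. -/
def periodMatrix (K : Type*) [Field K] : Matrix (Fin 2) (Fin 2) K⟦X⟧ :=
  !![hypT (1 / 3) (2 / 3) (1 / 2),
      -(C (3 / 2 : K) * X * hypT (7 / 6) (5 / 6) (3 / 2));
    -(X * hypT (2 / 3) (4 / 3) (3 / 2)),
      hypT (1 / 6) (5 / 6) (1 / 2)]

/-- Entrywise truncation of a matrix of power series: all terms of degree `≥ n` are dropped. -/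
def truncMatrix {R : Type*} [CommRing R] (n : ℕ) (A : Matrix (Fin 2) (Fin 2) R⟦X⟧) :
    Matrix (Fin 2) (Fin 2) R⟦X⟧ :=
  A.map fun g => ((trunc n g : Polynomial R) : R⟦X⟧)

/-- The matrix `A(t ^ k)` (used for `k ≥ 1` only). -/
def substPow {R : Type*} [CommRing R] (k : ℕ) (A : Matrix (Fin 2) (Fin 2) R⟦X⟧) :
    Matrix (Fin 2) (Fin 2) R⟦X⟧ :=
  A.map fun g => g.subst (X ^ k : R⟦X⟧)

/-- Entrywise congruence `A ≡ B mod q` of matrices over a commutative ring. -/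
def MatrixModEq {R : Type*} [CommRing R] (q : R) (A B : Matrix (Fin 2) (Fin 2) R) : Prop :=
  ∀ i j, A i j ≡ B i j [SMOD Ideal.span {q}]

end DworkMatrix

end

/-! Work in two variables a, v with t = a v. Let σ be a ↦ a^p, v ↦ v^p, give v weight 1 and a weight
-1, and let D = v∂_v - a∂_a (`eulerD`), which multiplies weight e by e and kills series in t; call
the image of D exact. Put Q = 1 - v² - a and ω_i = v^i/Q (`period`), i = 0, 1. For e ≥ 0 the weight
e part of ω_i is a series in t with k-th coefficient binom((3k - i + e)/2, k), or 0 if k + i + e is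
odd. As e → 0 p-adically through integers of the parity of j, it tends to the (i, j) entry of Y up
to sign (`congrUpTo_weightPart_period`, `map_padicPeriodMatrix`).

Frobenius structure (`period_frobenius`): modulo any power of p, ω_i is a combination of the σω_j
over ℤ_p[[t]] plus an exact term. Writing σQ = Q^p + p d, one expands 1/Q = Q^(p-1)/(σQ - p d) in
powers of p d/σQ. A monomial of weight prime to p over a power of σQ is exact. The others are σ of
forms with pole order k + 1, which `poleTerm_mem_exactSpan` reduces to ω_0, ω_1 at the cost of k!,
and p^k absorbs that cost.

Truncation: the terms of a-degree ≥ n in ω_i sum to g^n ω_i with g = a/(1 - v²). If p^s ∣ n, then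
modulo p^(s+1) both g^(pn) ≡ σ(g^n) and Dσ(g^n) ≡ 0, so multiplying the Frobenius relation by σ(g^n)
yields the same relation for tails, with the same coefficients (`weightPart_aTail_congr`). In weight
p e with p^s ∣ e the exact terms vanish modulo p^(s+1). Letting e → 0 gives Y - Y_{pn} ≡ M (Y -
Y_n)(t^p). The case n = 0 identifies M with Y(t) Y(t^p)⁻¹ modulo p^(s+1), and subtraction gives the
congruences. -/

noncomputable section

namespace DworkMatrix

/-! ### Series in a and v, the derivation D, Frobenius σ and weight parts. -/

section Bivariate

variable {A : Type*} [CommRing A]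

/-- The exponent of the monomial `a ^ i * v ^ j`. -/
def biExp (i j : ℕ) : Fin 2 →₀ ℕ := Finsupp.single 0 i + Finsupp.single 1 j

@[simp] lemma biExp_zero (i j : ℕ) : biExp i j 0 = i := by simp [biExp]

@[simp] lemma biExp_one (i j : ℕ) : biExp i j 1 = j := by simp [biExp]

lemma biExp_eta (n : Fin 2 →₀ ℕ) : biExp (n 0) (n 1) = n := by
  ext i; fin_cases i <;> simp

lemma biExp_inj {i j k l : ℕ} : biExp i j = biExp k l ↔ i = k ∧ j = l :=
  ⟨fun h => ⟨by simpa using DFunLike.congr_fun h 0, by simpa using DFunLike.congr_fun h 1⟩,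
    fun h => by rw [h.1, h.2]⟩

lemma biExp_add (i j k l : ℕ) : biExp i j + biExp k l = biExp (i + k) (j + l) := by
  ext x; fin_cases x <;> simp

lemma smul_biExp (c i j : ℕ) : c • biExp i j = biExp (c * i) (c * j) := by
  ext x; fin_cases x <;> simp

lemma biExp_le {i j k l : ℕ} : biExp i j ≤ biExp k l ↔ i ≤ k ∧ j ≤ l := by
  rw [Finsupp.le_def, Fin.forall_fin_two]; simp

lemma biExp_sub (i j k l : ℕ) : biExp i j - biExp k l = biExp (i - k) (j - l) := by
  ext x; fin_cases x <;> simp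

lemma ext_biExp {F G : MvPowerSeries (Fin 2) A}
    (h : ∀ i j, MvPowerSeries.coeff (biExp i j) F = MvPowerSeries.coeff (biExp i j) G) :
    F = G := by
  ext n; rw [← biExp_eta n]; exact h _ _

variable (A) in
/-- The monomial `a ^ i * v ^ j`. -/
def biMon (i j : ℕ) : MvPowerSeries (Fin 2) A := MvPowerSeries.monomial (biExp i j) 1

lemma biMon_mul (i j k l : ℕ) : biMon A i j * biMon A k l = biMon A (i + k) (j + l) := by
  simp [biMon, MvPowerSeries.monomial_mul_monomial, biExp_add]

lemma biMon_zero : biMon A 0 0 = 1 := by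
  have : biExp 0 0 = 0 := by ext x; fin_cases x <;> simp
  rw [biMon, this]; rfl

lemma biMon_pow (i j n : ℕ) : biMon A i j ^ n = biMon A (n * i) (n * j) := by
  induction n with
  | zero => simp [biMon_zero]
  | succ n ih => rw [pow_succ, ih, biMon_mul]; congr 1 <;> ring

lemma coeff_biMon_mul (i j k l : ℕ) (F : MvPowerSeries (Fin 2) A) :
    MvPowerSeries.coeff (biExp i j) (biMon A k l * F) =
      if k ≤ i ∧ l ≤ j then MvPowerSeries.coeff (biExp (i - k) (j - l)) F else 0 := by
  rw [biMon, MvPowerSeries.coeff_monomial_mul, one_mul, biExp_sub]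
  simp only [biExp_le]

lemma hasSubst_biMon_one_one : PowerSeries.HasSubst (biMon A 1 1) :=
  PowerSeries.HasSubst.monomial (fun h => by simpa using DFunLike.congr_fun h 0) 1

variable (A) in
/-- The substitution `t ↦ a * v`. -/
def diag : PowerSeries A →ₐ[A] MvPowerSeries (Fin 2) A :=
  PowerSeries.substAlgHom (R := A) (hasSubst_biMon_one_one (A := A))

lemma coeff_diag (f : PowerSeries A) (i j : ℕ) :
    MvPowerSeries.coeff (biExp i j) (diag A f) = if i = j then PowerSeries.coeff i f else 0 := by
  rw [diag, PowerSeries.coe_substAlgHom, PowerSeries.coeff_subst hasSubst_biMon_one_one,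
    finsum_eq_single _ i]
  · rw [biMon_pow, biMon, MvPowerSeries.coeff_monomial]
    simp only [biExp_inj, mul_one, true_and, smul_eq_mul, mul_ite, mul_zero, eq_comm (a := j)]
  · intro d hd
    rw [biMon_pow, biMon, MvPowerSeries.coeff_monomial]
    simp only [biExp_inj, mul_one]
    rw [if_neg (fun h => hd h.1.symm), smul_zero]

lemma diag_X : diag A PowerSeries.X = biMon A 1 1 :=
  PowerSeries.substAlgHom_X _

variable (A) in
/-- The derivation `v ∂/∂v - a ∂/∂a`, that is, `v d/dv` with `t = a * v` held constant. -/
def eulerD : Derivation A (MvPowerSeries (Fin 2) A) (MvPowerSeries (Fin 2) A) :=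
  biMon A 0 1 • MvPowerSeries.pderiv A 1 - biMon A 1 0 • MvPowerSeries.pderiv A 0

lemma coeff_eulerD (F : MvPowerSeries (Fin 2) A) (i j : ℕ) :
    MvPowerSeries.coeff (biExp i j) (eulerD A F) =
      ((j : A) - i) * MvPowerSeries.coeff (biExp i j) F := by
  have h1 : MvPowerSeries.coeff (biExp i j) (biMon A 0 1 * MvPowerSeries.pderiv A 1 F) =
      j * MvPowerSeries.coeff (biExp i j) F := by
    rw [coeff_biMon_mul]
    rcases j with _ | j
    · simp
    · rw [if_pos (by omega), MvPowerSeries.coeff_pderiv]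
      have : biExp (i - 0) (j + 1 - 1) + Finsupp.single 1 1 = biExp i (j + 1) := by
        ext x; fin_cases x <;> simp
      rw [this]; simp [mul_comm]
  have h2 : MvPowerSeries.coeff (biExp i j) (biMon A 1 0 * MvPowerSeries.pderiv A 0 F) =
      i * MvPowerSeries.coeff (biExp i j) F := by
    rw [coeff_biMon_mul]
    rcases i with _ | i
    · simp
    · rw [if_pos (by omega), MvPowerSeries.coeff_pderiv]
      have : biExp (i + 1 - 1) (j - 0) + Finsupp.single 0 1 = biExp (i + 1) j := by
        ext x; fin_cases x <;> simp
      rw [this]; simp [mul_comm]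
  rw [eulerD, Derivation.sub_apply, Derivation.smul_apply, Derivation.smul_apply, smul_eq_mul,
    smul_eq_mul, map_sub, h1, h2, sub_mul]

lemma eulerD_biMon (i j : ℕ) : eulerD A (biMon A i j) = ((j : A) - i) • biMon A i j := by
  refine ext_biExp fun k l => ?_
  rw [coeff_eulerD, map_smul, smul_eq_mul, biMon, MvPowerSeries.coeff_monomial]
  simp only [biExp_inj]
  split_ifs with h
  · rw [h.1, h.2]
  · simp

lemma eulerD_diag (f : PowerSeries A) : eulerD A (diag A f) = 0 := by
  refine ext_biExp fun i j => ?_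
  rw [coeff_eulerD, coeff_diag]
  split_ifs with h
  · simp [h]
  · simp

lemma eulerD_diag_mul (f : PowerSeries A) (F : MvPowerSeries (Fin 2) A) :
    eulerD A (diag A f * F) = diag A f * eulerD A F := by
  rw [Derivation.leibniz, eulerD_diag, smul_zero, add_zero, smul_eq_mul]

section Expand

variable {p : ℕ} (hp : p ≠ 0)

lemma coeff_expand_biExp (F : MvPowerSeries (Fin 2) A) (i j : ℕ) :
    MvPowerSeries.coeff (biExp i j) (MvPowerSeries.expand p hp F) =
      if p ∣ i ∧ p ∣ j then MvPowerSeries.coeff (biExp (i / p) (j / p)) F else 0 := by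
  split_ifs with h
  · obtain ⟨⟨i, rfl⟩, ⟨j, rfl⟩⟩ := h
    rw [← smul_biExp, MvPowerSeries.coeff_expand_smul, Nat.mul_div_cancel_left _ (by omega),
      Nat.mul_div_cancel_left _ (by omega)]
  · rw [not_and_or] at h
    rcases h with h | h
    · exact MvPowerSeries.coeff_expand_of_not_dvd p hp F (i := 0) (by simpa using h)
    · exact MvPowerSeries.coeff_expand_of_not_dvd p hp F (i := 1) (by simpa using h)

lemma expand_biMon (i j : ℕ) :
    MvPowerSeries.expand p hp (biMon A i j) = biMon A (p * i) (p * j) := by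
  rw [biMon, MvPowerSeries.expand_monomial, smul_biExp, biMon]

lemma expand_diag (f : PowerSeries A) :
    MvPowerSeries.expand p hp (diag A f) = diag A (PowerSeries.expand p hp f) := by
  refine ext_biExp fun i j => ?_
  rw [coeff_expand_biExp, coeff_diag, coeff_diag, PowerSeries.coeff_expand]
  by_cases hij : i = j
  · subst hij; simp
  · rw [if_neg hij]
    split_ifs with h1 h2
    · exact absurd ((Nat.div_left_inj h1.1 h1.2).1 h2) hij
    · rfl
    · rfl

lemma eulerD_expand (F : MvPowerSeries (Fin 2) A) :
    eulerD A (MvPowerSeries.expand p hp F) = p * MvPowerSeries.expand p hp (eulerD A F) := by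
  refine ext_biExp fun i j => ?_
  rw [coeff_eulerD, ← map_natCast (MvPowerSeries.C (σ := Fin 2) (R := A)),
    MvPowerSeries.coeff_C_mul, coeff_expand_biExp, coeff_expand_biExp]
  split_ifs with h
  · obtain ⟨⟨i, rfl⟩, ⟨j, rfl⟩⟩ := h
    rw [coeff_eulerD, Nat.mul_div_cancel_left _ (by omega), Nat.mul_div_cancel_left _ (by omega)]
    push_cast; ring
  · simp

end Expand

lemma toNat_natCast_mul (p : ℕ) (e : ℤ) : ((p : ℤ) * e).toNat = p * e.toNat := by
  rcases le_total 0 e with h | h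
  · obtain ⟨n, rfl⟩ := Int.eq_ofNat_of_zero_le h; norm_cast
  · rw [Int.toNat_of_nonpos h, mul_zero, Int.toNat_of_nonpos]
    exact mul_nonpos_of_nonneg_of_nonpos (by positivity) h

/-- The part of weight `e` of a power series in `a` and `v`, where `v` has weight `1` and `a` has
weight `-1`, read as a power series in `t = a * v`. -/
def weightPart (e : ℤ) (F : MvPowerSeries (Fin 2) A) : PowerSeries A :=
  PowerSeries.mk fun k => MvPowerSeries.coeff (biExp (k + (-e).toNat) (k + e.toNat)) F

lemma coeff_weightPart (e : ℤ) (F : MvPowerSeries (Fin 2) A) (k : ℕ) :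
    PowerSeries.coeff k (weightPart e F) =
      MvPowerSeries.coeff (biExp (k + (-e).toNat) (k + e.toNat)) F :=
  PowerSeries.coeff_mk _ _

lemma weightPart_add (e : ℤ) (F G : MvPowerSeries (Fin 2) A) :
    weightPart e (F + G) = weightPart e F + weightPart e G := by
  ext k; simp [coeff_weightPart]

lemma weightPart_natCast_mul (e : ℤ) (n : ℕ) (F : MvPowerSeries (Fin 2) A) :
    weightPart e ((n : MvPowerSeries (Fin 2) A) * F) = (n : PowerSeries A) * weightPart e F := by
  ext k
  rw [coeff_weightPart, ← map_natCast (MvPowerSeries.C (σ := Fin 2) (R := A)),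
    MvPowerSeries.coeff_C_mul, ← map_natCast (PowerSeries.C (R := A)),
    PowerSeries.coeff_C_mul, coeff_weightPart]

/-- This is why exact terms disappear: in a weight divisible by p^s they are divisible by p^s. -/
lemma weightPart_eulerD (e : ℤ) (F : MvPowerSeries (Fin 2) A) :
    weightPart e (eulerD A F) = e * weightPart e F := by
  ext k
  rw [coeff_weightPart, coeff_eulerD, ← map_intCast (PowerSeries.C (R := A)),
    PowerSeries.coeff_C_mul, coeff_weightPart]
  congr 1
  have : ((k + e.toNat : ℕ) : ℤ) - (k + (-e).toNat : ℕ) = e := by omega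
  exact_mod_cast congrArg (Int.cast (R := A)) this

lemma weightPart_diag_mul (e : ℤ) (f : PowerSeries A) (F : MvPowerSeries (Fin 2) A) :
    weightPart e (diag A f * F) = f * weightPart e F := by
  ext k
  rw [coeff_weightPart, MvPowerSeries.coeff_mul, PowerSeries.coeff_mul]
  symm
  refine Finset.sum_of_injOn
    (fun x => (biExp x.1 x.1, biExp (x.2 + (-e).toNat) (x.2 + e.toNat))) ?_ ?_ ?_ ?_
  · rintro ⟨x, y⟩ - ⟨x', y'⟩ - h
    simp only [Prod.mk.injEq, biExp_inj] at h ⊢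
    omega
  · rintro ⟨x, y⟩ h
    simp only [Finset.mem_coe, Finset.HasAntidiagonal.mem_antidiagonal] at h ⊢
    rw [biExp_add, biExp_inj]; omega
  · rintro ⟨x, y⟩ h hn
    rw [Finset.HasAntidiagonal.mem_antidiagonal] at h
    rw [← biExp_eta x, coeff_diag]
    split_ifs with hx
    · exfalso
      apply hn
      have h0 := DFunLike.congr_fun h 0
      have h1 := DFunLike.congr_fun h 1
      simp at h0 h1
      refine ⟨(x 0, k - x 0), ?_, ?_⟩
      · simp only [Finset.mem_coe, Finset.HasAntidiagonal.mem_antidiagonal]; omega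
      · simp only [Prod.mk.injEq]
        refine ⟨by rw [← biExp_eta x, biExp_inj]; simp [hx], ?_⟩
        rw [← biExp_eta y, biExp_inj]; omega
    · simp
  · rintro ⟨x, y⟩ h
    rw [coeff_diag, if_pos rfl, coeff_weightPart]

lemma weightPart_expand {p : ℕ} (hp : p ≠ 0) (e : ℤ) (F : MvPowerSeries (Fin 2) A) :
    weightPart (p * e) (MvPowerSeries.expand p hp F) =
      PowerSeries.expand p hp (weightPart e F) := by
  ext k
  have h1 := toNat_natCast_mul p e
  have h2 : (-(p * e)).toNat = p * (-e).toNat := by rw [← mul_neg, toNat_natCast_mul]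
  rw [coeff_weightPart, coeff_expand_biExp, PowerSeries.coeff_expand, h1, h2]
  simp only [Nat.dvd_add_left (dvd_mul_right _ _), and_self]
  split_ifs with h
  · obtain ⟨k, rfl⟩ := h
    rw [coeff_weightPart, ← mul_add, ← mul_add]
    simp only [Nat.mul_div_cancel_left _ (Nat.pos_of_ne_zero hp)]
  · rfl

variable (A) in
/-- The monomial of weight `e` in one of `a` and `v`. -/
def weightMon (e : ℤ) : MvPowerSeries (Fin 2) A := biMon A (-e).toNat e.toNat

lemma eulerD_weightMon (e : ℤ) : eulerD A (weightMon A e) = e * weightMon A e := by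
  rw [weightMon, eulerD_biMon, ← map_intCast (MvPowerSeries.C (σ := Fin 2) (R := A)),
    ← MvPowerSeries.smul_eq_C_mul]
  congr 1
  have : ((e.toNat : ℕ) : ℤ) - ((-e).toNat : ℕ) = e := by omega
  exact_mod_cast congrArg (Int.cast (R := A)) this

lemma expand_weightMon {p : ℕ} (hp : p ≠ 0) (e : ℤ) :
    MvPowerSeries.expand p hp (weightMon A e) = weightMon A (p * e) := by
  rw [weightMon, expand_biMon, weightMon, ← mul_neg, toNat_natCast_mul, toNat_natCast_mul]

end Bivariate

/-! ### Reduction of the pole order along Q = 1 - v² - a. -/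

section Reduction

variable {A : Type*} [CommRing A]

variable (A) in
/-- The trinomial `1 - v ^ 2 - a`. -/
def trinom : MvPowerSeries (Fin 2) A := 1 - biMon A 0 2 - biMon A 1 0

variable (A) in
/-- The inverse of `1 - v ^ 2 - a`. -/
def trinomInv : MvPowerSeries (Fin 2) A :=
  fun n => if 2 ∣ n 1 then ((n 0 + n 1 / 2).choose (n 0) : A) else 0

lemma coeff_trinomInv (i j : ℕ) :
    MvPowerSeries.coeff (biExp i j) (trinomInv A) =
      if 2 ∣ j then ((i + j / 2).choose i : A) else 0 := by
  rw [MvPowerSeries.coeff_apply, trinomInv, biExp_zero, biExp_one]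

lemma trinom_mul_trinomInv : trinom A * trinomInv A = 1 := by
  refine ext_biExp fun i j => ?_
  have h1 : MvPowerSeries.coeff (biExp i j) (1 : MvPowerSeries (Fin 2) A) =
      if i = 0 ∧ j = 0 then 1 else 0 := by
    rw [← biMon_zero, biMon, MvPowerSeries.coeff_monomial]
    simp only [biExp_inj]
  rw [trinom, sub_mul, sub_mul, one_mul, map_sub, map_sub, coeff_biMon_mul, coeff_biMon_mul,
    coeff_trinomInv, coeff_trinomInv, coeff_trinomInv, h1]
  by_cases hj : 2 ∣ j
  · obtain ⟨j, rfl⟩ := hj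
    rcases i with _ | i
    · rcases j with _ | j
      · simp
      · have : 2 ≤ 2 * (j + 1) := by omega
        simp [this]
    · rcases j with _ | j
      · simp
      · have e1 : 2 * (j + 1) / 2 = j + 1 := by omega
        have e2 : (2 * (j + 1) - 2) / 2 = j := by omega
        have e3 : 2 ∣ 2 * (j + 1) - 2 := by omega
        have e4 : 2 ≤ 2 * (j + 1) := by omega
        have e5 : i + 1 + (j + 1) = (i + (j + 1)) + 1 := by ring
        have e6 : i + 1 + j = i + (j + 1) := by ring
        simp only [e1, e2, e3, e4, e5, e6, Nat.choose_succ_succ, zero_le, and_self, if_true,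
          Nat.sub_zero, dvd_mul_right, le_add_iff_nonneg_left, Nat.add_sub_cancel, Nat.cast_add]
        simp
  · have e1 : ¬ (2 ≤ j ∧ 2 ∣ j - 2) := by omega
    have e2 : ¬ (i = 0 ∧ j = 0) := by rintro ⟨-, rfl⟩; exact hj (dvd_zero 2)
    simp only [Nat.sub_zero, hj, e2, if_false, ite_self, sub_zero, zero_le, true_and, zero_sub,
      neg_eq_zero]
    by_cases h : 2 ≤ j
    · rw [if_pos h, if_neg (fun h' => e1 ⟨h, h'⟩)]
    · rw [if_neg h]

lemma eulerD_trinom : eulerD A (trinom A) = biMon A 1 0 - 2 * biMon A 0 2 := by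
  rw [trinom, map_sub, map_sub, Derivation.map_one_eq_zero, eulerD_biMon, eulerD_biMon]
  simp only [Nat.cast_zero, Nat.cast_one, Nat.cast_ofNat, sub_zero, zero_sub, neg_smul, one_smul,
    sub_neg_eq_add, MvPowerSeries.smul_eq_C_mul, map_ofNat]
  ring

lemma eulerD_trinomInv :
    eulerD A (trinomInv A) = (2 * biMon A 0 2 - biMon A 1 0) * trinomInv A ^ 2 := by
  have h := congrArg (eulerD A) (trinom_mul_trinomInv (A := A))
  rw [Derivation.leibniz, Derivation.map_one_eq_zero, eulerD_trinom, smul_eq_mul, smul_eq_mul] at h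
  linear_combination trinomInv A * h - eulerD A (trinomInv A) * trinom_mul_trinomInv (A := A)

/-- Linear combinations of `x 0` and `x 1` over the power series in `t`, up to derivatives. -/
def exactSpan (x : Fin 2 → MvPowerSeries (Fin 2) A) : AddSubgroup (MvPowerSeries (Fin 2) A) where
  carrier := {F | ∃ (c : Fin 2 → PowerSeries A) (G : MvPowerSeries (Fin 2) A),
    F = ∑ j, diag A (c j) * x j + eulerD A G}
  add_mem' := by
    rintro _ _ ⟨c, G, rfl⟩ ⟨c', G', rfl⟩
    refine ⟨c + c', G + G', ?_⟩
    simp only [Fin.sum_univ_two, Pi.add_apply, map_add]; ring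
  zero_mem' := ⟨0, 0, by simp⟩
  neg_mem' := by
    rintro _ ⟨c, G, rfl⟩
    refine ⟨-c, -G, ?_⟩
    simp only [Fin.sum_univ_two, Pi.neg_apply, map_neg]; ring

variable {x : Fin 2 → MvPowerSeries (Fin 2) A}

lemma diag_mul_mem_exactSpan (f : PowerSeries A) {F : MvPowerSeries (Fin 2) A}
    (hF : F ∈ exactSpan x) : diag A f * F ∈ exactSpan x := by
  obtain ⟨c, G, rfl⟩ := hF
  refine ⟨fun j => f * c j, diag A f * G, ?_⟩
  rw [eulerD_diag_mul]
  simp only [Fin.sum_univ_two, map_mul]; ring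

lemma C_mul_mem_exactSpan (r : A) {F : MvPowerSeries (Fin 2) A}
    (hF : F ∈ exactSpan x) : MvPowerSeries.C r * F ∈ exactSpan x := by
  have h := diag_mul_mem_exactSpan (algebraMap A _ r) hF
  rwa [AlgHom.commutes] at h

lemma intCast_mul_mem_exactSpan (n : ℤ) {F : MvPowerSeries (Fin 2) A}
    (hF : F ∈ exactSpan x) : (n : MvPowerSeries (Fin 2) A) * F ∈ exactSpan x := by
  rw [← zsmul_eq_mul]; exact (exactSpan x).zsmul_mem hF n

lemma mem_exactSpan_of_isUnit_mul {f : PowerSeries A} (hf : IsUnit f)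
    {F : MvPowerSeries (Fin 2) A} (hF : diag A f * F ∈ exactSpan x) : F ∈ exactSpan x := by
  obtain ⟨g, hg⟩ := hf.exists_left_inv
  have h := diag_mul_mem_exactSpan g hF
  rwa [← mul_assoc, ← map_mul, hg, map_one, one_mul] at h

lemma eulerD_mem_exactSpan (F : MvPowerSeries (Fin 2) A) : eulerD A F ∈ exactSpan x :=
  ⟨0, F, by simp⟩

lemma basis_mem_exactSpan (j : Fin 2) : x j ∈ exactSpan x := by
  refine ⟨Pi.single j 1, 0, ?_⟩
  fin_cases j <;> simp

variable (A) in
/-- The basis `1 / (1 - v ^ 2 - a)`, `v / (1 - v ^ 2 - a)`. -/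
def period (j : Fin 2) : MvPowerSeries (Fin 2) A := biMon A 0 j * trinomInv A

lemma weightMon_mul_a_of_nonpos {e : ℤ} (he : e ≤ 0) :
    weightMon A e * biMon A 1 0 = weightMon A (e - 1) := by
  rw [weightMon, weightMon, biMon_mul]; congr 1 <;> omega

lemma weightMon_mul_a_of_pos {e : ℤ} (he : 0 < e) :
    weightMon A e * biMon A 1 0 = biMon A 1 1 * weightMon A (e - 1) := by
  rw [weightMon, weightMon, biMon_mul, biMon_mul]; congr 1 <;> omega

lemma weightMon_mul_sq_of_nonneg {e : ℤ} (he : 0 ≤ e) :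
    weightMon A e * biMon A 0 2 = weightMon A (e + 2) := by
  rw [weightMon, weightMon, biMon_mul]; congr 1 <;> omega

variable (A) in
/-- The form `k! * μ_e / (1 - v ^ 2 - a) ^ (k + 1)`. -/
def poleTerm (k : ℕ) (e : ℤ) : MvPowerSeries (Fin 2) A :=
  (k.factorial : MvPowerSeries (Fin 2) A) * weightMon A e * trinomInv A ^ (k + 1)

lemma poleTerm_def (k : ℕ) (e : ℤ) : poleTerm A k e =
    (k.factorial : MvPowerSeries (Fin 2) A) * weightMon A e * trinomInv A ^ (k + 1) := rfl

lemma eulerD_poleTerm (k : ℕ) (e : ℤ) :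
    eulerD A (poleTerm A k e) = e * poleTerm A k e +
      ((k + 1).factorial : MvPowerSeries (Fin 2) A) * weightMon A e *
        (2 * biMon A 0 2 - biMon A 1 0) * trinomInv A ^ (k + 2) := by
  rw [poleTerm, mul_assoc, Derivation.leibniz, Derivation.map_natCast, Derivation.leibniz,
    Derivation.leibniz_pow, eulerD_weightMon, eulerD_trinomInv, Nat.factorial_succ]
  simp only [smul_eq_mul, nsmul_eq_mul, Nat.add_sub_cancel]
  push_cast; ring

lemma poleTerm_eq (k : ℕ) (e : ℤ) :
    ((k : MvPowerSeries (Fin 2) A) + 1) * poleTerm A k e =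
      ((k + 1).factorial : MvPowerSeries (Fin 2) A) * weightMon A e *
        trinom A * trinomInv A ^ (k + 2) := by
  have h : trinomInv A ^ (k + 1) = trinom A * trinomInv A ^ (k + 2) := by
    rw [pow_succ _ (k + 1), mul_left_comm, trinom_mul_trinomInv, mul_one]
  rw [poleTerm, h, Nat.factorial_succ]; push_cast; ring

/-- Q · Q⁻¹ = 1 and the formula for D of a pole term give two relations between 1, v², a over
Q^(k+2); here v² is eliminated. -/
lemma poleTerm_sub_a (k : ℕ) (e : ℤ) :
    2 * poleTerm A (k + 1) e - 3 * (((k + 1).factorial : MvPowerSeries (Fin 2) A) *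
        (weightMon A e * biMon A 1 0) * trinomInv A ^ (k + 2)) =
      ((2 * (k + 1) - e : ℤ) : MvPowerSeries (Fin 2) A) * poleTerm A k e +
        eulerD A (poleTerm A k e) := by
  have h := poleTerm_eq (A := A) k e
  rw [eulerD_poleTerm]
  rw [trinom] at h
  rw [poleTerm_def (k + 1)]
  push_cast
  linear_combination -2 * h

/-- The companion relation, with a eliminated instead of v². -/
lemma poleTerm_sub_sq (k : ℕ) (e : ℤ) :
    poleTerm A (k + 1) e - 3 * (((k + 1).factorial : MvPowerSeries (Fin 2) A) *
        (weightMon A e * biMon A 0 2) * trinomInv A ^ (k + 2)) =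
      ((k + 1 + e : ℤ) : MvPowerSeries (Fin 2) A) * poleTerm A k e -
        eulerD A (poleTerm A k e) := by
  have h := poleTerm_eq (A := A) k e
  rw [eulerD_poleTerm]
  rw [trinom] at h
  rw [poleTerm_def (k + 1)]
  push_cast
  linear_combination - h

/-- Reduction of the pole order: the forms of pole order `k + 1` lie in the span of the periods
up to derivatives. -/
theorem poleTerm_mem_exactSpan (h2 : IsUnit (2 : A)) (h3 : IsUnit (3 : A)) (k : ℕ) :
    ∀ e : ℤ, -(k + 1 : ℤ) < e → e < 2 * (k + 1) → poleTerm A k e ∈ exactSpan (period A) := by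
  have c2 : IsUnit (2 : PowerSeries A) := by
    rw [← map_ofNat (PowerSeries.C (R := A)) 2]; exact h2.map _
  have c3 : IsUnit (3 : PowerSeries A) := by
    rw [← map_ofNat (PowerSeries.C (R := A)) 3]; exact h3.map _
  induction k with
  | zero =>
    intro e he1 he2
    have h : e = 0 ∨ e = 1 := by simp at he1 he2; omega
    rcases h with rfl | rfl
    · have := basis_mem_exactSpan (x := period A) 0
      simpa [poleTerm, period, weightMon] using this
    · have := basis_mem_exactSpan (x := period A) 1
      simpa [poleTerm, period, weightMon] using this
  | succ k ih =>
    set V := exactSpan (period A) with hV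
    set y := poleTerm A (k + 1) with hy
    have ra_mem : ∀ e : ℤ, -(k + 1 : ℤ) < e → e ≤ 2 * (k + 1) →
        2 * y e - 3 * (((k + 1).factorial : MvPowerSeries (Fin 2) A) *
          (weightMon A e * biMon A 1 0) * trinomInv A ^ (k + 2)) ∈ V := by
      intro e he1 he2
      rw [hy, poleTerm_sub_a]
      refine V.add_mem ?_ (eulerD_mem_exactSpan _)
      -- The extreme weight 2(k + 1) is outside the induction hypothesis, but there the coefficient
      -- 2(k + 1) - e vanishes. The same happens at weight -(k + 1) in the next relation.
      rcases he2.lt_or_eq with h | h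
      · exact intCast_mul_mem_exactSpan _ (ih e he1 h)
      · rw [h, sub_self, Int.cast_zero, zero_mul]; exact V.zero_mem
    have rsq_mem : ∀ e : ℤ, -(k + 1 : ℤ) ≤ e → e < 2 * (k + 1) →
        y e - 3 * (((k + 1).factorial : MvPowerSeries (Fin 2) A) *
          (weightMon A e * biMon A 0 2) * trinomInv A ^ (k + 2)) ∈ V := by
      intro e he1 he2
      rw [hy, poleTerm_sub_sq]
      refine V.sub_mem ?_ (eulerD_mem_exactSpan _)
      rcases he1.lt_or_eq with h | h
      · exact intCast_mul_mem_exactSpan _ (ih e h he2)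
      · rw [← h, add_neg_cancel, Int.cast_zero, zero_mul]; exact V.zero_mem
    have ra_nonpos : ∀ e : ℤ, -(k + 1 : ℤ) < e → e ≤ 0 → 2 * y e - 3 * y (e - 1) ∈ V := by
      intro e he1 he2
      have := ra_mem e he1 (by omega)
      rwa [weightMon_mul_a_of_nonpos he2] at this
    have ra_pos : ∀ e : ℤ, 0 < e → e ≤ 2 * (k + 1) →
        2 * y e - 3 * (diag A PowerSeries.X * y (e - 1)) ∈ V := by
      intro e he1 he2
      have := ra_mem e (by omega) he2
      rw [weightMon_mul_a_of_pos he1] at this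
      rw [diag_X, hy, poleTerm_def _ (e - 1)]
      convert this using 2
      ring
    have rsq_nonneg : ∀ e : ℤ, 0 ≤ e → e < 2 * (k + 1) → y e - 3 * y (e + 2) ∈ V := by
      intro e he1 he2
      have := rsq_mem e (by omega) he2
      rwa [weightMon_mul_sq_of_nonneg he1] at this
    have m0 : y 0 ∈ V := by
      have r1 := rsq_nonneg 0 le_rfl (by omega)
      have r2 := ra_pos 1 one_pos (by omega)
      have r3 := ra_pos 2 two_pos (by omega)
      norm_num at r1 r2 r3
      -- Modulo V: y₀ ≡ 3y₂, 2y₂ ≡ 3t y₁, 2y₁ ≡ 3t y₀. Going round the cycle gives (4 - 27t²) y₀ ≡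
      -- 0; the factor is the discriminant, a unit because 2 is.
      have u : IsUnit (4 - 27 * PowerSeries.X ^ 2 : PowerSeries A) := by
        rw [PowerSeries.isUnit_iff_constantCoeff]
        have := h2.mul h2
        norm_num at this
        rw [map_sub, map_mul, map_pow, PowerSeries.constantCoeff_X, map_ofNat]
        simpa using this
      refine mem_exactSpan_of_isUnit_mul u ?_
      have := V.add_mem (V.add_mem (intCast_mul_mem_exactSpan 4 r1)
        (intCast_mul_mem_exactSpan 6 r3)) (diag_mul_mem_exactSpan (9 * PowerSeries.X) r2)
      convert this using 1
      simp only [map_sub, map_mul, map_pow, map_ofNat]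
      push_cast; ring
    have m1 : y 1 ∈ V := by
      have r2 := ra_pos 1 one_pos (by omega)
      norm_num at r2
      refine mem_exactSpan_of_isUnit_mul c2 ?_
      have := V.add_mem r2 (diag_mul_mem_exactSpan (3 * PowerSeries.X) m0)
      convert this using 1
      simp only [map_mul, map_ofNat]; ring
    have mpos : ∀ n : ℕ, (n : ℤ) < 2 * (k + 1) + 2 → y n ∈ V := by
      intro n
      induction n using Nat.strong_induction_on with
      | _ n ihn =>
        intro hn
        rcases n with _ | _ | n
        · simpa using m0
        · simpa using m1
        · have r := rsq_nonneg n (by omega) (by push_cast at hn; omega)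
          have hm := ihn n (by omega) (by push_cast at hn ⊢; omega)
          refine mem_exactSpan_of_isUnit_mul c3 ?_
          have := V.sub_mem hm r
          convert this using 1
          simp only [map_ofNat]; push_cast; ring_nf
    have mneg : ∀ n : ℕ, (n : ℤ) ≤ k + 1 → y (-n) ∈ V := by
      intro n
      induction n with
      | zero => intro _; simpa using m0
      | succ n ihn =>
        intro hn
        push_cast at hn
        have r := ra_nonpos (-n) (by omega) (by omega)
        refine mem_exactSpan_of_isUnit_mul c3 ?_
        have := V.sub_mem (intCast_mul_mem_exactSpan 2 (ihn (by omega))) r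
        convert this using 1
        simp only [map_ofNat]; push_cast; ring_nf
    intro e he1 he2
    push_cast at he1 he2
    rcases le_total 0 e with h | h
    · have := mpos e.toNat (by omega)
      rwa [Int.toNat_of_nonneg h] at this
    · have := mneg (-e).toNat (by omega)
      rwa [Int.toNat_of_nonneg (by omega), neg_neg] at this

end Reduction

/-! ### Bounds on weights, and the error term d of σ as a lift of Frobenius. -/

section Box

variable {A : Type*} [CommRing A]

/-- All terms of `F` have weight between `lo` and `hi`. -/
def WeightBounded (lo hi : ℤ) (F : MvPowerSeries (Fin 2) A) : Prop :=
  ∀ i j : ℕ, MvPowerSeries.coeff (biExp i j) F ≠ 0 → lo ≤ (j : ℤ) - i ∧ (j : ℤ) - i ≤ hi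

lemma WeightBounded.mono {lo hi lo' hi' : ℤ} {F : MvPowerSeries (Fin 2) A}
    (h : WeightBounded lo hi F) (h1 : lo' ≤ lo) (h2 : hi ≤ hi') : WeightBounded lo' hi' F :=
  fun i j hij => ⟨h1.trans (h i j hij).1, (h i j hij).2.trans h2⟩

lemma WeightBounded.sub {lo hi : ℤ} {F G : MvPowerSeries (Fin 2) A}
    (hF : WeightBounded lo hi F) (hG : WeightBounded lo hi G) : WeightBounded lo hi (F - G) := by
  intro i j h
  by_cases hf : MvPowerSeries.coeff (biExp i j) F = 0
  · refine hG i j fun hg => h ?_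
    rw [map_sub, hf, hg, sub_zero]
  · exact hF i j hf

lemma weightBounded_biMon (i j : ℕ) : WeightBounded ((j : ℤ) - i) (j - i) (biMon A i j) := by
  intro k l h
  rw [biMon, MvPowerSeries.coeff_monomial] at h
  have h' : biExp k l = biExp i j := by
    by_contra hn; exact h (if_neg hn)
  rw [biExp_inj] at h'
  rw [h'.1, h'.2]
  exact ⟨le_rfl, le_rfl⟩

lemma WeightBounded.mul {lo hi lo' hi' : ℤ} {F G : MvPowerSeries (Fin 2) A}
    (hF : WeightBounded lo hi F) (hG : WeightBounded lo' hi' G) :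
    WeightBounded (lo + lo') (hi + hi') (F * G) := by
  intro i j h
  rw [MvPowerSeries.coeff_mul] at h
  obtain ⟨⟨m, n⟩, hmn, hne⟩ := Finset.exists_ne_zero_of_sum_ne_zero h
  rw [Finset.HasAntidiagonal.mem_antidiagonal] at hmn
  have h1 := hF (m 0) (m 1) (by rw [biExp_eta]; exact left_ne_zero_of_mul hne)
  have h2 := hG (n 0) (n 1) (by rw [biExp_eta]; exact right_ne_zero_of_mul hne)
  have e0 := DFunLike.congr_fun hmn 0
  have e1 := DFunLike.congr_fun hmn 1
  simp at e0 e1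
  omega

lemma WeightBounded.pow {lo hi : ℤ} {F : MvPowerSeries (Fin 2) A}
    (hF : WeightBounded lo hi F) (n : ℕ) : WeightBounded (n * lo) (n * hi) (F ^ n) := by
  induction n with
  | zero => simpa [biMon_zero] using weightBounded_biMon (A := A) 0 0
  | succ n ih =>
    rw [pow_succ]
    refine (ih.mul hF).mono (le_of_eq ?_) (le_of_eq ?_) <;> push_cast <;> ring

lemma coeff_diag_mul_weightMon (f : PowerSeries A) (e : ℤ) (i j : ℕ) :
    MvPowerSeries.coeff (biExp i j) (diag A f * weightMon A e) =
      if (j : ℤ) - i = e then PowerSeries.coeff (min i j) f else 0 := by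
  rw [mul_comm, weightMon, coeff_biMon_mul, coeff_diag]
  by_cases h : (j : ℤ) - i = e
  · rw [if_pos h, if_pos (by omega), if_pos (by omega)]
    congr 2; omega
  · rw [if_neg h]
    split_ifs with h1 h2
    · omega
    · rfl
    · rfl

lemma WeightBounded.eq_sum {lo hi : ℤ} {F : MvPowerSeries (Fin 2) A}
    (hF : WeightBounded lo hi F) :
    F = ∑ e ∈ Finset.Icc lo hi, diag A (weightPart e F) * weightMon A e := by
  refine ext_biExp fun i j => ?_
  rw [map_sum]
  simp only [coeff_diag_mul_weightMon, coeff_weightPart]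
  rw [Finset.sum_ite_eq]
  split_ifs with h
  · have : biExp i j = biExp (min i j + (-((j : ℤ) - i)).toNat) (min i j + ((j : ℤ) - i).toNat) :=
      biExp_inj.2 ⟨by omega, by omega⟩
    rw [← this]
  · by_contra hne
    exact h (Finset.mem_Icc.2 (hF i j hne))

lemma exists_eulerD_eq {F : MvPowerSeries (Fin 2) A}
    (h : ∀ i j : ℕ, ∃ c, MvPowerSeries.coeff (biExp i j) F = ((j : A) - i) * c) :
    ∃ G, F = eulerD A G := by
  choose c hc using h
  let G : MvPowerSeries (Fin 2) A := fun n => c (n 0) (n 1)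
  refine ⟨G, ext_biExp fun i j => ?_⟩
  have hG : MvPowerSeries.coeff (biExp i j) G = c i j := by
    change c (biExp i j 0) (biExp i j 1) = c i j
    rw [biExp_zero, biExp_one]
  rw [coeff_eulerD, hc, hG]

lemma weightBounded_trinom : WeightBounded (-1) 2 (trinom A) := by
  have h0 := weightBounded_biMon (A := A) 0 0
  rw [biMon_zero] at h0
  refine ((h0.mono ?_ ?_).sub ((weightBounded_biMon 0 2).mono ?_ ?_)).sub
    ((weightBounded_biMon 1 0).mono ?_ ?_) <;> simp

lemma expand_trinom {p : ℕ} (hp : p ≠ 0) :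
    MvPowerSeries.expand p hp (trinom A) = 1 - biMon A 0 (p * 2) - biMon A p 0 := by
  rw [trinom, map_sub, map_sub, map_one, expand_biMon, expand_biMon, mul_zero, mul_one]

lemma weightBounded_expand_trinom {p : ℕ} (hp : p ≠ 0) :
    WeightBounded (p * (-1)) (p * 2) (MvPowerSeries.expand p hp (trinom A)) := by
  have h0 := weightBounded_biMon (A := A) 0 0
  rw [biMon_zero] at h0
  rw [expand_trinom]
  refine ((h0.mono ?_ ?_).sub ((weightBounded_biMon 0 (p * 2)).mono ?_ ?_)).sub
    ((weightBounded_biMon p 0).mono ?_ ?_) <;> simp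
  all_goals omega

lemma exists_sub_pow_prime_eq {R : Type*} [CommRing R] {p : ℕ} (hp : p.Prime) (ho : Odd p)
    (x y : R) : ∃ r, (x - y) ^ p = x ^ p - y ^ p + p * r := by
  obtain ⟨r, hr⟩ := exists_add_pow_prime_eq hp x (-y)
  refine ⟨x * -y * r, ?_⟩
  rw [sub_eq_add_neg, hr, ho.neg_pow]; ring

lemma exists_expand_trinom_eq {p : ℕ} (hp : p.Prime) (ho : Odd p) :
    ∃ d, MvPowerSeries.expand p hp.ne_zero (trinom A) = trinom A ^ p + p * d := by
  obtain ⟨r, hr⟩ := exists_sub_pow_prime_eq hp ho (1 - biMon A 0 2) (biMon A 1 0)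
  obtain ⟨r', hr'⟩ := exists_sub_pow_prime_eq hp ho 1 (biMon A 0 2)
  refine ⟨-r - r', ?_⟩
  rw [expand_trinom, trinom, hr, hr', biMon_pow, biMon_pow, mul_zero, mul_one]
  ring

end Box

/-! ### The Frobenius matrix of ω_0, ω_1 modulo powers of p. -/

section Frobenius

variable {p : ℕ} [hp : Fact p.Prime]

lemma isUnit_intCast_padicInt {e : ℤ} (h : ¬ (p : ℤ) ∣ e) : IsUnit (e : ℤ_[p]) := by
  rw [PadicInt.isUnit_iff]
  refine le_antisymm (PadicInt.norm_le_one _) ?_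
  by_contra hlt
  exact h ((PadicInt.norm_int_lt_one_iff_dvd e).1 (not_le.1 hlt))

/-- Legendre: k! has valuation at most k - 1. The spare factor p is what turns σ(D G) into D(σ G).
-/
lemma exists_factorial_mul_eq_pow (k : ℕ) (hk : k ≠ 0) :
    ∃ r : ℤ_[p], (p : ℤ_[p]) ^ k = r * (p * k.factorial) := by
  obtain ⟨v, u, hu, huv⟩ := Nat.exists_eq_pow_mul_and_not_dvd k.factorial_ne_zero p hp.out.ne_one
  have hv : v < k := by
    refine lt_of_le_of_lt ?_ (padicValNat_factorial_lt_of_ne_zero p hk)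
    exact (padicValNat_dvd_iff_le k.factorial_ne_zero).1 ⟨u, huv⟩
  obtain ⟨c, hc⟩ := (isUnit_intCast_padicInt (p := p) (e := u)
    (fun h => hu (Int.natCast_dvd_natCast.1 h))).exists_left_inv
  push_cast at hc
  refine ⟨c * p ^ (k - 1 - v), ?_⟩
  rw [huv]
  push_cast
  have hpk : (p : ℤ_[p]) ^ k = p ^ (k - 1 - v) * p ^ v * p := by
    rw [← pow_add, ← pow_succ]; congr 1; omega
  linear_combination hpk - p ^ (k - 1 - v) * p ^ v * p * hc

lemma eulerD_of_not_dvd {e : ℤ} (he : ¬ (p : ℤ) ∣ e) (F : MvPowerSeries (Fin 2) ℤ_[p]) :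
    ∃ G, weightMon ℤ_[p] e * MvPowerSeries.expand p hp.out.ne_zero F = eulerD ℤ_[p] G := by
  refine exists_eulerD_eq fun i j => ?_
  -- All terms have weight congruent to e mod p, so the coefficient vanishes in a weight divisible
  -- by p; in any other weight one divides by the weight, a unit.
  by_cases h : (p : ℤ) ∣ (j : ℤ) - i
  · refine ⟨0, ?_⟩
    rw [mul_zero, weightMon, coeff_biMon_mul]
    split_ifs with h1
    · rw [coeff_expand_biExp, if_neg]
      rintro ⟨h2, h3⟩
      apply he
      have h2' := Int.natCast_dvd_natCast.2 h2
      have h3' := Int.natCast_dvd_natCast.2 h3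
      have : e = ((j : ℤ) - i) - (((j - e.toNat : ℕ) : ℤ) - (i - (-e).toNat : ℕ)) := by omega
      rw [this]
      exact dvd_sub h (dvd_sub h3' h2')
    · rfl
  · obtain ⟨c, hc⟩ := (isUnit_intCast_padicInt h).exists_right_inv
    push_cast at hc
    exact ⟨c * MvPowerSeries.coeff (biExp i j) (weightMon ℤ_[p] e *
      MvPowerSeries.expand p hp.out.ne_zero F), by rw [← mul_assoc, hc, one_mul]⟩

/-- The image of the basis `period` under `a ↦ a ^ p`, `v ↦ v ^ p`. -/
def periodFrob (p : ℕ) [hp : Fact p.Prime] (j : Fin 2) : MvPowerSeries (Fin 2) ℤ_[p] :=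
  MvPowerSeries.expand p hp.out.ne_zero (period ℤ_[p] j)

lemma isUnit_two_three (h3 : 3 < p) : IsUnit (2 : ℤ_[p]) ∧ IsUnit (3 : ℤ_[p]) := by
  constructor
  · have := isUnit_intCast_padicInt (p := p) (e := 2)
      (fun h => by have := Int.le_of_dvd two_pos h; omega)
    exact_mod_cast this
  · have := isUnit_intCast_padicInt (p := p) (e := 3)
      (fun h => by have := Int.le_of_dvd three_pos h; omega)
    exact_mod_cast this

lemma pow_mul_weightMon_mem (h3 : 3 < p) (k : ℕ) (e : ℤ) (he1 : -(p * (k + 1) : ℤ) < e)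
    (he2 : e < 2 * (p * (k + 1))) :
    (p : MvPowerSeries (Fin 2) ℤ_[p]) ^ k * (weightMon ℤ_[p] e *
      MvPowerSeries.expand p hp.out.ne_zero (trinomInv ℤ_[p]) ^ (k + 1)) ∈
        exactSpan (periodFrob p) := by
  have hp0 : (0 : ℤ) < p := by exact_mod_cast hp.out.pos
  by_cases he : (p : ℤ) ∣ e
  · obtain ⟨e, rfl⟩ := he
    have h1 : -(k + 1 : ℤ) < e := by nlinarith
    have h2 : e < 2 * (k + 1) := by nlinarith
    rcases Nat.eq_zero_or_pos k with rfl | hk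
    · have h : e = 0 ∨ e = 1 := by simp at h1 h2; omega
      rw [← expand_weightMon hp.out.ne_zero, ← map_pow, ← map_mul, pow_zero, one_mul]
      rcases h with rfl | rfl
      · simpa [periodFrob, period, weightMon] using basis_mem_exactSpan (x := periodFrob p) 0
      · simpa [periodFrob, period, weightMon] using basis_mem_exactSpan (x := periodFrob p) 1
    · obtain ⟨c, G, hG⟩ := poleTerm_mem_exactSpan (isUnit_two_three h3).1 (isUnit_two_three h3).2
        k e h1 h2
      obtain ⟨r, hr⟩ := exists_factorial_mul_eq_pow (p := p) k hk.ne'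
      have hr' := congrArg (MvPowerSeries.C (σ := Fin 2)) hr
      simp only [map_pow, map_mul, map_natCast] at hr'
      have h := congrArg (MvPowerSeries.expand p hp.out.ne_zero) hG
      rw [poleTerm_def, map_mul, map_mul, map_natCast, map_add, map_pow, expand_weightMon] at h
      have key : (p : MvPowerSeries (Fin 2) ℤ_[p]) ^ k * (weightMon ℤ_[p] (p * e) *
          MvPowerSeries.expand p hp.out.ne_zero (trinomInv ℤ_[p]) ^ (k + 1)) =
          MvPowerSeries.C r * (((p : ℤ) : MvPowerSeries (Fin 2) ℤ_[p]) * (∑ j, diag ℤ_[p] (PowerSeries.expand p hp.out.ne_zero (c j))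
            * periodFrob p j) + eulerD ℤ_[p] (MvPowerSeries.expand p hp.out.ne_zero G)) := by
        rw [hr', eulerD_expand]
        simp only [map_sum, map_mul, expand_diag] at h
        simp only [periodFrob]
        push_cast
        linear_combination (MvPowerSeries.C r * p) * h
      rw [key]
      refine C_mul_mem_exactSpan _ (AddSubgroup.add_mem _ (intCast_mul_mem_exactSpan _ ?_)
        (eulerD_mem_exactSpan _))
      exact AddSubgroup.sum_mem _ fun j _ => diag_mul_mem_exactSpan _ (basis_mem_exactSpan j)
  · obtain ⟨G, hG⟩ := eulerD_of_not_dvd he (trinomInv ℤ_[p] ^ (k + 1))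
    rw [map_pow] at hG
    rw [hG]
    have := intCast_mul_mem_exactSpan ((p : ℤ) ^ k) (eulerD_mem_exactSpan (x := periodFrob p) G)
    push_cast at this
    exact this

lemma pow_mul_weightBounded_mem (h3 : 3 < p) (k : ℕ) {F : MvPowerSeries (Fin 2) ℤ_[p]}
    (hF : WeightBounded (1 - p * (k + 1)) (2 * (p * (k + 1)) - 1) F) :
    (p : MvPowerSeries (Fin 2) ℤ_[p]) ^ k * (F *
      MvPowerSeries.expand p hp.out.ne_zero (trinomInv ℤ_[p]) ^ (k + 1)) ∈
        exactSpan (periodFrob p) := by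
  rw [hF.eq_sum, Finset.sum_mul, Finset.mul_sum]
  refine AddSubgroup.sum_mem _ fun e he => ?_
  rw [Finset.mem_Icc] at he
  have := diag_mul_mem_exactSpan (weightPart e F)
    (pow_mul_weightMon_mem h3 k e (by omega) (by omega))
  convert this using 1
  ring

/-- Modulo `p ^ s`, the periods are combinations of their Frobenius images up to derivatives. -/
theorem period_frobenius (h3 : 3 < p) (s : ℕ) :
    ∃ (c : Fin 2 → Fin 2 → PowerSeries ℤ_[p]) (G H : Fin 2 → MvPowerSeries (Fin 2) ℤ_[p]),
      ∀ i, period ℤ_[p] i = ∑ j, diag ℤ_[p] (c i j) * periodFrob p j + eulerD ℤ_[p] (G i) +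
        (p : MvPowerSeries (Fin 2) ℤ_[p]) ^ s * H i := by
  obtain ⟨d, hd⟩ := exists_expand_trinom_eq (A := ℤ_[p]) hp.out
    (hp.out.odd_of_ne_two (by omega))
  -- p d = σQ - Q^p has this support, and ℤ_p has no p-torsion.
  have hdb : WeightBounded (p * (-1)) (p * 2) d := by
    have h := (weightBounded_expand_trinom (A := ℤ_[p]) hp.out.ne_zero).sub
      (weightBounded_trinom.pow p)
    rw [hd, add_sub_cancel_left] at h
    intro i j hij
    refine h i j ?_
    rw [← map_natCast (MvPowerSeries.C (σ := Fin 2) (R := ℤ_[p])), MvPowerSeries.coeff_C_mul]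
    exact mul_ne_zero (Nat.cast_ne_zero.2 hp.out.ne_zero) hij
  set w := MvPowerSeries.expand p hp.out.ne_zero (trinomInv ℤ_[p]) with hw
  have hwq : MvPowerSeries.expand p hp.out.ne_zero (trinom ℤ_[p]) * w = 1 := by
    rw [hw, ← map_mul, trinom_mul_trinomInv, map_one]
  have key : ∀ i : Fin 2, ∃ F ∈ exactSpan (periodFrob p), ∃ H, period ℤ_[p] i =
      F + (p : MvPowerSeries (Fin 2) ℤ_[p]) ^ s * H := by
    intro i
    -- The geometric series of v^i Q^(p-1)/(σQ - p d), cut after s terms; its remainder is the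
    -- second witness.
    refine ⟨∑ k ∈ Finset.range s, (p : MvPowerSeries (Fin 2) ℤ_[p]) ^ k *
      ((biMon ℤ_[p] 0 i * trinom ℤ_[p] ^ (p - 1) * d ^ k) * w ^ (k + 1)), ?_,
      period ℤ_[p] i * (d * w) ^ s, ?_⟩
    · refine AddSubgroup.sum_mem _ fun k _ => pow_mul_weightBounded_mem h3 k ?_
      -- Having Q^(p-1) rather than Q^p leaves room for v^i with i ≤ 1: the weights stay strictly
      -- between -p(k + 1) and 2p(k + 1), as the pole reduction requires.
      refine (((weightBounded_biMon 0 i).mul (weightBounded_trinom.pow (p - 1))).mul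
        (hdb.pow k)).mono ?_ ?_
      · rw [Nat.cast_sub hp.out.one_le]; push_cast
        have : (0 : ℤ) ≤ (i : ℕ) := by positivity
        nlinarith
      · rw [Nat.cast_sub hp.out.one_le]; push_cast
        have : ((i : ℕ) : ℤ) ≤ 1 := by exact_mod_cast Nat.lt_succ_iff.1 i.2
        nlinarith
    · have hq : trinom ℤ_[p] ^ p * w = 1 - p * (d * w) := by
        linear_combination hwq - w * hd
      have hg := mul_neg_geom_sum ((p : MvPowerSeries (Fin 2) ℤ_[p]) * (d * w)) s
      have hpp : trinom ℤ_[p] ^ p = trinom ℤ_[p] * trinom ℤ_[p] ^ (p - 1) := by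
        rw [← pow_succ', Nat.sub_add_cancel hp.out.one_le]
      have hsum : ∑ k ∈ Finset.range s, (p : MvPowerSeries (Fin 2) ℤ_[p]) ^ k *
          ((biMon ℤ_[p] 0 i * trinom ℤ_[p] ^ (p - 1) * d ^ k) * w ^ (k + 1)) =
          biMon ℤ_[p] 0 i * trinom ℤ_[p] ^ (p - 1) * w *
            ∑ k ∈ Finset.range s, ((p : MvPowerSeries (Fin 2) ℤ_[p]) * (d * w)) ^ k := by
        rw [Finset.mul_sum]
        exact Finset.sum_congr rfl fun k _ => by ring
      rw [hsum]
      rw [← hq, hpp, mul_pow] at hg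
      rw [period]
      linear_combination (-biMon ℤ_[p] 0 i * trinomInv ℤ_[p]) * hg +
        (biMon ℤ_[p] 0 i * trinom ℤ_[p] ^ (p - 1) * w *
          ∑ k ∈ Finset.range s, ((p : MvPowerSeries (Fin 2) ℤ_[p]) * (d * w)) ^ k) *
          trinom_mul_trinomInv (A := ℤ_[p])
  choose F hF H hH using key
  choose c G hG using hF
  exact ⟨c, G, H, fun i => by rw [hH i, hG i]⟩

end Frobenius

/-! ### Tails in a as multiplication by powers of g = a/(1 - v²). -/

section Tail

variable {A : Type*} [CommRing A]

/-- The terms of degree at least `n` in `a`. -/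
def aTail (n : ℕ) (F : MvPowerSeries (Fin 2) A) : MvPowerSeries (Fin 2) A :=
  fun m => if n ≤ m 0 then MvPowerSeries.coeff m F else 0

lemma coeff_aTail (n : ℕ) (F : MvPowerSeries (Fin 2) A) (i j : ℕ) :
    MvPowerSeries.coeff (biExp i j) (aTail n F) =
      if n ≤ i then MvPowerSeries.coeff (biExp i j) F else 0 := by
  change (if n ≤ biExp i j 0 then _ else _) = _
  rw [biExp_zero]

lemma aTail_zero (F : MvPowerSeries (Fin 2) A) : aTail 0 F = F :=
  ext_biExp fun i j => by rw [coeff_aTail, if_pos (Nat.zero_le _)]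

lemma aTail_biMon_mul (n k : ℕ) (F : MvPowerSeries (Fin 2) A) :
    aTail n (biMon A 0 k * F) = biMon A 0 k * aTail n F := by
  refine ext_biExp fun i j => ?_
  rw [coeff_aTail, coeff_biMon_mul, coeff_biMon_mul, coeff_aTail, Nat.sub_zero]
  split_ifs <;> rfl

/-- Take the terms of a-degree > n in (1 - v²)/Q = 1 + a/Q; the constant 1 drops out. -/
lemma binom_mul_aTail_succ (n : ℕ) :
    (1 - biMon A 0 2) * aTail (n + 1) (trinomInv A) = biMon A 1 0 * aTail n (trinomInv A) := by
  have h : (1 - biMon A 0 2) * trinomInv A = biMon A 0 0 + biMon A 1 0 * trinomInv A := by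
    have := trinom_mul_trinomInv (A := A)
    rw [trinom] at this
    rw [biMon_zero]
    linear_combination this
  refine ext_biExp fun i j => ?_
  have hc := congrArg (MvPowerSeries.coeff (biExp i j)) h
  rw [sub_mul, one_mul, map_sub, map_add, coeff_biMon_mul, coeff_biMon_mul, biMon,
    MvPowerSeries.coeff_monomial] at hc
  rw [sub_mul, one_mul, map_sub, coeff_biMon_mul, coeff_biMon_mul, coeff_aTail, coeff_aTail,
    coeff_aTail]
  simp only [Nat.sub_zero, zero_le, true_and, and_true, biExp_inj] at hc ⊢
  by_cases hn : n + 1 ≤ i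
  · rw [if_neg (show ¬(i = 0 ∧ j = 0) by omega), zero_add, if_pos (show 1 ≤ i by omega)] at hc
    rw [if_pos hn, if_pos hn, if_pos (show 1 ≤ i by omega), if_pos (show n ≤ i - 1 by omega), hc]
  · rw [if_neg hn, if_neg hn, ite_self, sub_zero]
    split_ifs
    · omega
    · rfl
    · rfl

lemma aTail_trinomInv {b : MvPowerSeries (Fin 2) A} (hb : (1 - biMon A 0 2) * b = 1) (n : ℕ) :
    aTail n (trinomInv A) = (biMon A 1 0 * b) ^ n * trinomInv A := by
  induction n with
  | zero => rw [aTail_zero, pow_zero, one_mul]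
  | succ n ih =>
    have h := binom_mul_aTail_succ (A := A) n
    rw [ih] at h
    linear_combination b * h - aTail (n + 1) (trinomInv A) * hb

lemma aTail_period {b : MvPowerSeries (Fin 2) A} (hb : (1 - biMon A 0 2) * b = 1) (n : ℕ)
    (j : Fin 2) : aTail n (period A j) = (biMon A 1 0 * b) ^ n * period A j := by
  rw [period, aTail_biMon_mul, aTail_trinomInv hb]; ring

/-- The truncation of a power series, as a power series. -/
abbrev truncSeries (n : ℕ) (f : PowerSeries A) : PowerSeries A :=
  (PowerSeries.trunc n f : Polynomial A)

lemma truncSeries_zero (f : PowerSeries A) : truncSeries 0 f = 0 := by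
  simp [truncSeries]

/-- For e ≥ 0 the coefficient of t^k comes from a^k v^(k+e), so cutting in a is cutting in t. -/
lemma weightPart_aTail {e : ℤ} (he : 0 ≤ e) (n : ℕ) (F : MvPowerSeries (Fin 2) A) :
    weightPart e (aTail n F) =
      weightPart e F - truncSeries n (weightPart e F) := by
  ext k
  rw [coeff_weightPart, coeff_aTail, map_sub, Polynomial.coeff_coe, PowerSeries.coeff_trunc,
    coeff_weightPart]
  have : k + (-e).toNat = k := by omega
  rw [this]
  split_ifs
  · omega
  · simp
  · simp
  · omega

lemma exists_binom_inv : ∃ b, (1 - biMon A 0 2) * b = 1 := by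
  have h : IsUnit (1 - biMon A 0 2) := by
    rw [MvPowerSeries.isUnit_iff_constantCoeff]
    have : MvPowerSeries.constantCoeff (biMon A 0 2) = 0 := by
      rw [← MvPowerSeries.coeff_zero_eq_constantCoeff_apply, biMon, MvPowerSeries.coeff_monomial,
        if_neg]
      intro h
      simpa using DFunLike.congr_fun h 1
    rw [map_sub, map_one, this, sub_zero]
    exact isUnit_one
  exact h.exists_right_inv

/-- Both sides are a^p times an inverse, of (1 - v²)^p and of 1 - v^(2p), which agree modulo p. -/
lemma expand_sub_pow_dvd {p : ℕ} (hp : p.Prime) (ho : Odd p) {b : MvPowerSeries (Fin 2) A}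
    (hb : (1 - biMon A 0 2) * b = 1) :
    (p : MvPowerSeries (Fin 2) A) ∣
      (biMon A 1 0 * b) ^ p - MvPowerSeries.expand p hp.ne_zero (biMon A 1 0 * b) := by
  obtain ⟨r, hr⟩ := exists_sub_pow_prime_eq hp ho 1 (biMon A 0 2)
  have h := congrArg (MvPowerSeries.expand p hp.ne_zero) hb
  rw [map_mul, map_sub, map_one, expand_biMon] at h
  rw [biMon_pow, one_pow] at hr
  rw [map_mul, expand_biMon, mul_pow, biMon_pow]
  have hbp : (1 - biMon A 0 2) ^ p * b ^ p = 1 := by rw [← mul_pow, hb, one_pow]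
  refine ⟨-biMon A p 0 * b ^ p * MvPowerSeries.expand p hp.ne_zero b * r, ?_⟩
  simp only [mul_zero, mul_one] at *
  rw [hr] at hbp
  linear_combination (-biMon A p 0 * b ^ p) * h +
    biMon A p 0 * MvPowerSeries.expand p hp.ne_zero b * hbp

end Tail

/-! ### Congruences for tails in weights divisible by p^s. -/

section Congruence

variable {p : ℕ} [hp : Fact p.Prime]

/-- The congruences for the tails of the coefficient series of weight `e`, `p ^ s ∣ e`. -/
theorem weightPart_aTail_congr (h3 : 3 < p) (s : ℕ) :
    ∃ c : Fin 2 → Fin 2 → PowerSeries ℤ_[p], ∀ (i : Fin 2) (e n : ℕ), p ^ s ∣ e → p ^ s ∣ n →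
      (p : PowerSeries ℤ_[p]) ^ (s + 1) ∣
        weightPart ((p * e : ℕ) : ℤ) (aTail (p * n) (period ℤ_[p] i)) -
          ∑ j, c i j * PowerSeries.expand p hp.out.ne_zero
            (weightPart (e : ℤ) (aTail n (period ℤ_[p] j))) := by
  obtain ⟨c, G, H, hGH⟩ := period_frobenius h3 (s + 1)
  refine ⟨c, ?_⟩
  rintro i _ _ ⟨e, rfl⟩ ⟨m, rfl⟩
  obtain ⟨b, hb⟩ := exists_binom_inv (A := ℤ_[p])
  set g := biMon ℤ_[p] 1 0 * b with hg
  set σ := MvPowerSeries.expand (σ := Fin 2) (R := ℤ_[p]) p hp.out.ne_zero with hσ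
  obtain ⟨K, hK⟩ : (p : MvPowerSeries (Fin 2) ℤ_[p]) ^ (s + 1) ∣
      g ^ (p * (p ^ s * m)) - σ (g ^ (p ^ s * m)) := by
    have h1 := dvd_sub_pow_of_dvd_sub
      (expand_sub_pow_dvd hp.out (hp.out.odd_of_ne_two (by omega)) hb) s
    have h2 := h1.trans (sub_dvd_pow_sub_pow _ _ m)
    rwa [← pow_mul, ← pow_mul, ← pow_mul, ← map_pow] at h2
  -- The Leibniz rule for the power gives p^s, and D σ = p σ D gives one more p.
  have hD : eulerD ℤ_[p] (σ (g ^ (p ^ s * m))) =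
      (p : MvPowerSeries (Fin 2) ℤ_[p]) ^ (s + 1) *
        σ (m * (g ^ (p ^ s * m - 1) * eulerD ℤ_[p] g)) := by
    rw [hσ, eulerD_expand, Derivation.leibniz_pow]
    simp only [smul_eq_mul, nsmul_eq_mul, map_mul, map_natCast]
    push_cast; ring
  have main : aTail (p * (p ^ s * m)) (period ℤ_[p] i) =
      ∑ j, diag ℤ_[p] (c i j) * σ (aTail (p ^ s * m) (period ℤ_[p] j)) +
        eulerD ℤ_[p] (G i * σ (g ^ (p ^ s * m))) +
        ((p ^ (s + 1) : ℕ) : MvPowerSeries (Fin 2) ℤ_[p]) * (H i * σ (g ^ (p ^ s * m)) +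
          K * period ℤ_[p] i - G i * σ (m * (g ^ (p ^ s * m - 1) * eulerD ℤ_[p] g))) := by
    rw [aTail_period hb, Derivation.leibniz, hD]
    simp only [aTail_period hb, map_mul σ _ (period ℤ_[p] _), Fin.sum_univ_two, smul_eq_mul]
    have h := hGH i
    simp only [Fin.sum_univ_two, periodFrob, ← hσ] at h
    push_cast
    linear_combination period ℤ_[p] i * hK + σ (g ^ (p ^ s * m)) * h
  rw [main, weightPart_add, weightPart_add, weightPart_eulerD, weightPart_natCast_mul,
    Fin.sum_univ_two, weightPart_add, weightPart_diag_mul, weightPart_diag_mul, Fin.sum_univ_two]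
  push_cast
  have hw := fun F => weightPart_expand (A := ℤ_[p]) hp.out.ne_zero ((p : ℤ) ^ s * e) F
  rw [hw, hw]
  -- The first summand is the exact term, whose weight p · p^s e supplies p^(s+1).
  refine ⟨e * weightPart (p * (p ^ s * e)) (G i * σ (g ^ (p ^ s * m))) +
    weightPart (p * (p ^ s * e)) (H i * σ (g ^ (p ^ s * m)) +
          K * period ℤ_[p] i - G i * σ (m * (g ^ (p ^ s * m - 1) * eulerD ℤ_[p] g))), ?_⟩
  ring

end Congruence

/-! ### The entries of Y as generalized binomial series. -/

section Hypergeometric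

variable {K : Type*} [Field K]

lemma coeff_hypT (a b c : K) (k : ℕ) :
    PowerSeries.coeff k (hypT a b c) =
      if 2 ∣ k then (27 / 4) ^ (k / 2) * ordinaryHypergeometricCoefficient a b c (k / 2)
      else 0 := by
  have hs : PowerSeries.HasSubst (PowerSeries.C (27 / 4 : K) * PowerSeries.X ^ 2) :=
    PowerSeries.HasSubst.of_constantCoeff_zero' (by simp)
  have hterm : ∀ d : ℕ, PowerSeries.coeff k
      ((PowerSeries.C (27 / 4 : K) * PowerSeries.X ^ 2) ^ d) =
        if k = 2 * d then (27 / 4) ^ d else 0 := by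
    intro d
    rw [mul_pow, ← pow_mul, ← map_pow, PowerSeries.coeff_C_mul, PowerSeries.coeff_X_pow, mul_ite,
      mul_one, mul_zero]
  rw [hypT, PowerSeries.coeff_subst' hs, finsum_eq_single _ (k / 2)]
  · rw [hterm, hyp, PowerSeries.coeff_mk, smul_eq_mul, mul_comm]
    by_cases h : 2 ∣ k
    · rw [if_pos h, if_pos (by omega)]
    · rw [if_neg h, if_neg (by omega), zero_mul]
  · intro d hd
    rw [hterm, if_neg (by omega), smul_zero]

variable [CharZero K]

lemma factorial_mul_choose (r : K) (k : ℕ) :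
    (k.factorial : K) * Ring.choose r k = (descPochhammer K k).eval r := by
  rw [← nsmul_eq_mul, ← Ring.descPochhammer_eq_factorial_smul_choose,
    ← Polynomial.aeval_eq_smeval, ← descPochhammer_map (Int.castRingHom K) k,
    Polynomial.eval_map, Polynomial.aeval_def]
  rfl

/-- Raising k by 2 in binom((3k - i)/2, k) raises the upper argument by 3; this is the resulting
term ratio, to be matched with the hypergeometric one. -/
lemma choose_add_three (r : K) (k : ℕ) :
    Ring.choose (r + 3) (k + 2) * ((k + 2) * (k + 1) * (r - k + 1)) =
      Ring.choose r k * ((r + 3) * (r + 2) * (r + 1)) := by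
  have hs : ∀ (x : K) (n : ℕ), (descPochhammer K (n + 1)).eval x =
      x * (descPochhammer K n).eval (x - 1) := by
    intro x n
    rw [descPochhammer_succ_left, Polynomial.eval_mul, Polynomial.eval_X, Polynomial.eval_comp]
    simp
  have h0 := factorial_mul_choose r k
  have h1 := factorial_mul_choose (r + 3) (k + 2)
  have e1 := hs (r + 3) (k + 1)
  have e2 := hs (r + 2) k
  have e3 := hs (r + 1) k
  have e4 := descPochhammer_succ_eval k (r + 1)
  rw [show r + 3 - 1 = r + 2 by ring] at e1
  rw [show r + 2 - 1 = r + 1 by ring] at e2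
  rw [show r + 1 - 1 = r by ring] at e3
  rw [Nat.factorial_succ, Nat.factorial_succ] at h1
  push_cast at h1
  have hk : (k.factorial : K) ≠ 0 := Nat.cast_ne_zero.2 k.factorial_ne_zero
  apply mul_left_cancel₀ hk
  linear_combination (r - k + 1) * h1 + (r - k + 1) * e1 + (r - k + 1) * (r + 3) * e2 -
    (r + 3) * (r + 2) * e4 + (r + 3) * (r + 2) * e3 - (r + 3) * (r + 2) * (r + 1) * h0

lemma hypergeometricCoefficient_succ (a b c : K) (n : ℕ) (hc : c + n ≠ 0) :
    ordinaryHypergeometricCoefficient a b c (n + 1) * ((c + n) * (n + 1)) =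
      ordinaryHypergeometricCoefficient a b c n * ((a + n) * (b + n)) := by
  have hn : (n : K) + 1 ≠ 0 := by exact_mod_cast n.succ_ne_zero
  simp only [ordinaryHypergeometricCoefficient, ascPochhammer_succ_eval, Nat.factorial_succ,
    Nat.cast_mul, mul_inv, Nat.cast_add, Nat.cast_one]
  field_simp

/-- Two sequences satisfying the same first order recurrence agree. -/
lemma hypergeometric_eq_choose {a b c r u : K} {k : ℕ}
    (h0 : Ring.choose r k = u)
    (hc : ∀ n : ℕ, c + n ≠ 0)
    (hr : ∀ n : ℕ, r + 3 * n - (k + 2 * n) + 1 ≠ 0)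
    (h : ∀ n : ℕ, (r + 3 * n + 3) * (r + 3 * n + 2) * (r + 3 * n + 1) * ((c + n) * (n + 1)) =
      27 / 4 * ((a + n) * (b + n)) *
        ((k + 2 * n + 2) * (k + 2 * n + 1) * (r + 3 * n - (k + 2 * n) + 1)))
    (n : ℕ) :
    Ring.choose (r + 3 * n) (k + 2 * n) =
      u * ((27 / 4) ^ n * ordinaryHypergeometricCoefficient a b c n) := by
  induction n with
  | zero => simp [ordinaryHypergeometricCoefficient, h0]
  | succ n ih =>
    have hn1 : (n : K) + 1 ≠ 0 := by exact_mod_cast n.succ_ne_zero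
    have hk1 : (k : K) + 2 * n + 1 ≠ 0 := by exact_mod_cast (k + 2 * n).succ_ne_zero
    have hk2 : (k : K) + 2 * n + 2 ≠ 0 := by exact_mod_cast (k + 2 * n + 1).succ_ne_zero
    have e1 := choose_add_three (r + 3 * n) (k + 2 * n)
    have e2 := hypergeometricCoefficient_succ a b c n (hc n)
    rw [ih] at e1
    push_cast at e1 ⊢
    rw [show r + 3 * ((n : K) + 1) = r + 3 * n + 3 by ring,
      show k + 2 * (n + 1) = k + 2 * n + 2 by ring]
    have hne : ((k : K) + 2 * n + 2) * (k + 2 * n + 1) * (r + 3 * n - (k + 2 * n) + 1) ≠ 0 :=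
      mul_ne_zero (mul_ne_zero hk2 hk1) (hr n)
    have hne2 : (c + n) * ((n : K) + 1) ≠ 0 := mul_ne_zero (hc n) hn1
    apply mul_right_cancel₀ hne
    apply mul_right_cancel₀ hne2
    rw [pow_succ]
    linear_combination ((c + n) * ((n : K) + 1)) * e1 +
      u * (27 / 4) ^ n * ordinaryHypergeometricCoefficient a b c n * h n -
      u * (27 / 4) ^ n * (27 / 4) * (((k : K) + 2 * n + 2) * (k + 2 * n + 1) *
        (r + 3 * n - (k + 2 * n) + 1)) * e2

lemma ne_zero_of_natCast_eq {x y : K} {n : ℕ} (h : y * x = n) (hn : n ≠ 0) :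
    x ≠ 0 := by
  rintro rfl
  rw [mul_zero] at h
  exact hn (by exact_mod_cast h.symm)

variable (K) in
/-- The entries of `periodMatrix`, up to sign, as generalized binomial series. -/
def halfBinomSeries (i j : ℕ) : PowerSeries K :=
  PowerSeries.mk fun k => if 2 ∣ k + i + j then Ring.choose ((3 * k - i) * 2⁻¹ : K) k else 0

lemma coeff_halfBinomSeries (i j k : ℕ) : PowerSeries.coeff k (halfBinomSeries K i j) =
    if 2 ∣ k + i + j then Ring.choose ((3 * k - i) * 2⁻¹ : K) k else 0 :=
  PowerSeries.coeff_mk _ _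

lemma hypT_eq_zero_zero : hypT (1 / 3) (2 / 3) (1 / 2) = halfBinomSeries K 0 0 := by
  ext k
  rw [coeff_hypT, coeff_halfBinomSeries, add_zero, add_zero]
  split_ifs with h
  · obtain ⟨n, rfl⟩ := h
    have := hypergeometric_eq_choose (K := K) (a := 1 / 3) (b := 2 / 3) (c := 1 / 2) (r := 0)
      (u := 1) (k := 0) (Ring.choose_zero_right _)
      (fun n => ne_zero_of_natCast_eq (y := 2) (n := 2 * n + 1) (by push_cast; ring) (by omega))
      (fun n => ne_zero_of_natCast_eq (y := 1) (n := n + 1) (by push_cast; ring) (by omega))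
      (fun n => by push_cast; ring) n
    rw [Nat.mul_div_cancel_left _ two_pos, ← one_mul (_ * _), ← this, zero_add, zero_add]
    congr 1
    push_cast; ring
  · rfl

lemma hypT_eq_one_one : hypT (1 / 6) (5 / 6) (1 / 2) = halfBinomSeries K 1 1 := by
  ext k
  rw [coeff_hypT, coeff_halfBinomSeries]
  by_cases h : 2 ∣ k
  · rw [if_pos h, if_pos (by omega)]
    obtain ⟨n, rfl⟩ := h
    have := hypergeometric_eq_choose (K := K) (a := 1 / 6) (b := 5 / 6) (c := 1 / 2)
      (r := - 1 / 2) (u := 1) (k := 0) (Ring.choose_zero_right _)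
      (fun n => ne_zero_of_natCast_eq (y := 2) (n := 2 * n + 1) (by push_cast; ring) (by omega))
      (fun n => ne_zero_of_natCast_eq (y := 2) (n := 2 * n + 1) (by push_cast; ring) (by omega))
      (fun n => by push_cast; ring) n
    rw [Nat.mul_div_cancel_left _ two_pos, ← one_mul (_ * _), ← this, zero_add]
    congr 1
    push_cast; ring
  · rw [if_neg h, if_neg (by omega)]

lemma hypT_eq_zero_one :
    PowerSeries.C (3 / 2 : K) * PowerSeries.X * hypT (7 / 6) (5 / 6) (3 / 2) =
      halfBinomSeries K 0 1 := by
  ext k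
  rw [coeff_halfBinomSeries, mul_assoc, PowerSeries.coeff_C_mul]
  rcases k with _ | k
  · simp
  rw [PowerSeries.coeff_succ_X_mul, coeff_hypT]
  by_cases h : 2 ∣ k
  · rw [if_pos h, if_pos (by omega)]
    obtain ⟨n, rfl⟩ := h
    have := hypergeometric_eq_choose (K := K) (a := 7 / 6) (b := 5 / 6) (c := 3 / 2)
      (r := 3 / 2) (u := 3 / 2) (k := 1) (Ring.choose_one_right _)
      (fun n => ne_zero_of_natCast_eq (y := 2) (n := 2 * n + 3) (by push_cast; ring) (by omega))
      (fun n => ne_zero_of_natCast_eq (y := 2) (n := 2 * n + 3) (by push_cast; ring) (by omega))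
      (fun n => by push_cast; ring) n
    rw [Nat.mul_div_cancel_left _ two_pos, ← this, add_comm 1]
    congr 1
    push_cast; ring
  · rw [if_neg h, if_neg (by omega), mul_zero]

lemma hypT_eq_one_zero :
    PowerSeries.X * hypT (2 / 3) (4 / 3) (3 / 2) = halfBinomSeries K 1 0 := by
  ext k
  rw [coeff_halfBinomSeries]
  rcases k with _ | k
  · simp
  rw [PowerSeries.coeff_succ_X_mul, coeff_hypT]
  by_cases h : 2 ∣ k
  · rw [if_pos h, if_pos (by omega)]
    obtain ⟨n, rfl⟩ := h
    have := hypergeometric_eq_choose (K := K) (a := 2 / 3) (b := 4 / 3) (c := 3 / 2)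
      (r := 1) (u := 1) (k := 1) (Ring.choose_one_right _)
      (fun n => ne_zero_of_natCast_eq (y := 2) (n := 2 * n + 3) (by push_cast; ring) (by omega))
      (fun n => ne_zero_of_natCast_eq (y := 1) (n := n + 1) (by push_cast; ring) (by omega))
      (fun n => by push_cast; ring) n
    rw [Nat.mul_div_cancel_left _ two_pos, ← one_mul (_ * _), ← this, add_comm 1 (2 * n)]
    congr 1
    push_cast; ring
  · rw [if_neg h, if_neg (by omega)]

end Hypergeometric

/-! ### Congruences of coefficients up to a given degree. -/

section CongrUpTo

variable {A : Type*} [CommRing A]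

/-- The coefficients of `f` and `g` in degrees at most `N` are congruent modulo `q`. -/
def CongrUpTo (q : A) (N : ℕ) (f g : PowerSeries A) : Prop :=
  ∀ k ≤ N, q ∣ PowerSeries.coeff k f - PowerSeries.coeff k g

variable {q : A} {N : ℕ} {f g h f' g' : PowerSeries A}

lemma CongrUpTo.symm (hfg : CongrUpTo q N f g) : CongrUpTo q N g f := fun k hk => by
  rw [dvd_sub_comm]; exact hfg k hk

lemma CongrUpTo.trans (hfg : CongrUpTo q N f g) (hgh : CongrUpTo q N g h) : CongrUpTo q N f h :=
  fun k hk => by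
    have := dvd_add (hfg k hk) (hgh k hk)
    rwa [sub_add_sub_cancel] at this

lemma CongrUpTo.add (h1 : CongrUpTo q N f g) (h2 : CongrUpTo q N f' g') :
    CongrUpTo q N (f + f') (g + g') := fun k hk => by
  rw [map_add, map_add, add_sub_add_comm]
  exact dvd_add (h1 k hk) (h2 k hk)

lemma CongrUpTo.mul_left (c : PowerSeries A) (hfg : CongrUpTo q N f g) :
    CongrUpTo q N (c * f) (c * g) := fun k hk => by
  rw [← map_sub, ← mul_sub, PowerSeries.coeff_mul]
  refine Finset.dvd_sum fun x hx => dvd_mul_of_dvd_right ?_ _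
  rw [map_sub]
  exact hfg _ ((Finset.HasAntidiagonal.antidiagonal.snd_le hx).trans hk)

lemma CongrUpTo.expand {p : ℕ} (hp : p ≠ 0) (hfg : CongrUpTo q N f g) :
    CongrUpTo q N (PowerSeries.expand p hp f) (PowerSeries.expand p hp g) := fun k hk => by
  rw [PowerSeries.coeff_expand, PowerSeries.coeff_expand]
  split_ifs
  · exact hfg _ ((Nat.div_le_self k p).trans hk)
  · simp

lemma CongrUpTo.sub_trunc (n : ℕ) (hfg : CongrUpTo q N f g) :
    CongrUpTo q N (f - truncSeries n f)
      (g - truncSeries n g) := fun k hk => by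
  simp only [map_sub, Polynomial.coeff_coe, PowerSeries.coeff_trunc]
  split_ifs
  · simp
  · simpa using hfg k hk

lemma C_dvd_iff : PowerSeries.C q ∣ f ↔ ∀ k, q ∣ PowerSeries.coeff k f := by
  constructor
  · rintro ⟨g, rfl⟩ k
    rw [PowerSeries.coeff_C_mul]
    exact dvd_mul_right _ _
  · intro h
    choose c hc using h
    refine ⟨PowerSeries.mk c, ?_⟩
    ext k
    rw [PowerSeries.coeff_C_mul, PowerSeries.coeff_mk, hc]

lemma congrUpTo_of_dvd (h : PowerSeries.C q ∣ f - g) : CongrUpTo q N f g := fun k _ => by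
  rw [← map_sub]; exact C_dvd_iff.1 h k

lemma dvd_of_congrUpTo (h : ∀ N, CongrUpTo q N f g) : PowerSeries.C q ∣ f - g :=
  C_dvd_iff.2 fun k => by rw [map_sub]; exact h k k le_rfl

end CongrUpTo

/-! ### Passing to the p-adic limit e → 0 in the weight. -/

section Approximation

variable {p : ℕ} [hp : Fact p.Prime]

/-- Continuity of x ↦ binom(x, k): k! binom(x, k) is a polynomial with integer coefficients, and k!
can be cancelled. -/
lemma choose_sub_choose_dvd {q x y : ℤ_[p]} {k : ℕ} (h : q * k.factorial ∣ x - y) :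
    q ∣ Ring.choose x k - Ring.choose y k := by
  have hk : (k.factorial : ℤ_[p]) ≠ 0 := Nat.cast_ne_zero.2 k.factorial_ne_zero
  have hf : ∀ z : ℤ_[p], (k.factorial : ℤ_[p]) * Ring.choose z k =
      ((descPochhammer ℤ k).map (Int.castRingHom ℤ_[p])).eval z := by
    intro z
    rw [← nsmul_eq_mul, ← Ring.descPochhammer_eq_factorial_smul_choose,
      ← Polynomial.aeval_eq_smeval, Polynomial.eval_map, Polynomial.aeval_def]
    rfl
  have h1 := h.trans (Polynomial.sub_dvd_eval_sub x y
    ((descPochhammer ℤ k).map (Int.castRingHom ℤ_[p])))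
  rw [← hf, ← hf, ← mul_sub, mul_comm q] at h1
  exact (mul_dvd_mul_iff_left hk).1 h1

lemma exists_dvd_pow {x : ℤ_[p]} (hx : x ≠ 0) : ∃ n : ℕ, x ∣ (p : ℤ_[p]) ^ n := by
  refine ⟨x.valuation, ?_⟩
  conv_lhs => rw [PadicInt.unitCoeff_spec hx]
  simp

variable (p) in
/-- The entries of the matrix `Y`, up to sign. -/
def padicBinomSeries (half : ℤ_[p]) (i j : ℕ) : PowerSeries ℤ_[p] :=
  PowerSeries.mk fun k => if 2 ∣ k + i + j then Ring.choose ((3 * k - i) * half) k else 0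

lemma coeff_padicBinomSeries (half : ℤ_[p]) (i j k : ℕ) :
    PowerSeries.coeff k (padicBinomSeries p half i j) =
      if 2 ∣ k + i + j then Ring.choose ((3 * k - i) * half) k else 0 :=
  PowerSeries.coeff_mk _ _

lemma map_padicBinomSeries {half : ℤ_[p]} (hh : 2 * half = 1) (i j : ℕ) :
    PowerSeries.map (algebraMap ℤ_[p] ℚ_[p]) (padicBinomSeries p half i j) =
      halfBinomSeries ℚ_[p] i j := by
  have hh' : algebraMap ℤ_[p] ℚ_[p] half = 2⁻¹ := by
    have := congrArg (algebraMap ℤ_[p] ℚ_[p]) hh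
    rw [map_mul, map_one, map_ofNat] at this
    exact eq_inv_of_mul_eq_one_right this
  ext k
  rw [PowerSeries.coeff_map, coeff_padicBinomSeries, coeff_halfBinomSeries]
  split_ifs
  · rw [Ring.map_choose, map_mul, hh', map_sub, map_mul, map_ofNat, map_natCast, map_natCast]
  · simp

lemma coeff_weightPart_period {half : ℤ_[p]} (hh : 2 * half = 1) (i : Fin 2) (e k : ℕ) :
    PowerSeries.coeff k (weightPart (e : ℤ) (period ℤ_[p] i)) =
      if 2 ∣ k + i + e then Ring.choose ((3 * k - (i : ℕ)) * half + e * half) k else 0 := by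
  have hi : (i : ℕ) ≤ 1 := Nat.lt_succ_iff.1 i.2
  rw [coeff_weightPart, period, coeff_biMon_mul]
  have h1 : k + (-(e : ℤ)).toNat = k := by omega
  have h2 : k + (e : ℤ).toNat = k + e := by omega
  rw [h1, h2, coeff_trinomInv, Nat.sub_zero]
  by_cases h : 2 ∣ k + i + e
  · obtain ⟨m, hm⟩ : 2 ∣ k + e - i := by omega
    have hle : (i : ℕ) ≤ k + e := by omega
    rw [if_pos h, if_pos ⟨Nat.zero_le _, hle⟩, if_pos ⟨m, hm⟩, hm,
      Nat.mul_div_cancel_left _ two_pos, ← Ring.choose_natCast]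
    congr 1
    have hc : (k : ℤ_[p]) + e = 2 * m + (i : ℕ) := by
      have : k + e = 2 * m + i := by omega
      exact_mod_cast congrArg (Nat.cast (R := ℤ_[p])) this
    push_cast
    linear_combination (-(k : ℤ_[p]) - m) * hh - half * hc
  · rw [if_neg h]
    split_ifs
    · omega
    · rfl
    · rfl

lemma congrUpTo_weightPart_period {half : ℤ_[p]} (hh : 2 * half = 1) (q : ℤ_[p]) (N : ℕ)
    (i : Fin 2) (j e : ℕ) (hpar : 2 ∣ j + e) (he : q * N.factorial ∣ (e : ℤ_[p])) :
    CongrUpTo q N (weightPart (e : ℤ) (period ℤ_[p] i)) (padicBinomSeries p half i j) := by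
  intro k hk
  rw [coeff_weightPart_period hh, coeff_padicBinomSeries]
  by_cases h : 2 ∣ k + i + j
  · rw [if_pos h, if_pos (by omega)]
    apply choose_sub_choose_dvd
    rw [add_sub_cancel_left]
    refine dvd_mul_of_dvd_left (dvd_trans (mul_dvd_mul_left _ ?_) he) _
    exact Nat.cast_dvd_cast (Nat.factorial_dvd_factorial hk)
  · rw [if_neg h, if_neg (by omega), sub_zero]
    exact dvd_zero _

/-- The coefficients c do not depend on the weight, so for each degree bound N a weight close enough
to 0 may be used. -/
theorem padicBinomSeries_tail_congr (h3 : 3 < p) {half : ℤ_[p]} (hh : 2 * half = 1) (s : ℕ) :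
    ∃ c : Fin 2 → Fin 2 → PowerSeries ℤ_[p], ∀ (i j : Fin 2) (n : ℕ), p ^ s ∣ n →
      PowerSeries.C ((p : ℤ_[p]) ^ (s + 1)) ∣
        (padicBinomSeries p half i j -
          truncSeries (p * n) (padicBinomSeries p half i j)) -
        ∑ l : Fin 2, c i l * PowerSeries.expand p hp.out.ne_zero (padicBinomSeries p half l j -
          truncSeries n (padicBinomSeries p half l j)) := by
  obtain ⟨c, hc⟩ := weightPart_aTail_congr h3 s
  refine ⟨c, fun i j n hn => dvd_of_congrUpTo fun N => ?_⟩
  set q : ℤ_[p] := (p : ℤ_[p]) ^ (s + 1) with hq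
  obtain ⟨L, hL⟩ := exists_dvd_pow (p := p) (x := (N.factorial : ℤ_[p]))
    (Nat.cast_ne_zero.2 N.factorial_ne_zero)
  obtain ⟨e, hpar, hes, he⟩ : ∃ e : ℕ, 2 ∣ (j : ℕ) + e ∧ p ^ s ∣ e ∧
      q * N.factorial ∣ (e : ℤ_[p]) := by
    have hodd : Odd p := hp.out.odd_of_ne_two (by omega)
    -- Column 0 is weight 0 itself; column 1 needs an odd weight near 0, hence a high power of the
    -- odd prime p. Then p e has the same parity as e.
    refine ⟨j * p ^ (s + 1 + L), ?_, ?_, ?_⟩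
    · have h1 : Odd (p ^ (s + 1 + L)) := hodd.pow
      have : (j : ℕ) + j * p ^ (s + 1 + L) = j * (1 + p ^ (s + 1 + L)) := by ring
      rw [this]
      exact dvd_mul_of_dvd_right (odd_one.add_odd h1).two_dvd _
    · exact dvd_mul_of_dvd_right (pow_dvd_pow _ (by omega)) _
    · push_cast
      rw [pow_add]
      exact dvd_mul_of_dvd_right (mul_dvd_mul_left _ hL) _
  have hpe : 2 ∣ (j : ℕ) + p * e := by
    have hodd : Odd p := hp.out.odd_of_ne_two (by omega)
    obtain ⟨m, hm⟩ := hodd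
    rw [hm, add_mul, one_mul, mul_assoc]
    omega
  have hpe' : q * N.factorial ∣ ((p * e : ℕ) : ℤ_[p]) := by
    push_cast; exact dvd_mul_of_dvd_right he _
  have h := hc i e n hes hn
  rw [weightPart_aTail (Int.natCast_nonneg _)] at h
  simp only [weightPart_aTail (Int.natCast_nonneg _)] at h
  have hC : PowerSeries.C q = (p : PowerSeries ℤ_[p]) ^ (s + 1) := by simp [hq]
  rw [← hC] at h
  refine ((congrUpTo_weightPart_period hh q N i j _ hpe hpe').symm.sub_trunc (p * n)).trans
    ((congrUpTo_of_dvd h).trans ?_)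
  rw [Fin.sum_univ_two, Fin.sum_univ_two]
  exact ((((congrUpTo_weightPart_period hh q N 0 j e hpar he).sub_trunc n).expand _).mul_left
    _).add ((((congrUpTo_weightPart_period hh q N 1 j e hpar he).sub_trunc n).expand _).mul_left _)

end Approximation

/-! ### The matrix form and the Dwork congruences. -/

section Assembly

variable {p : ℕ} [hp : Fact p.Prime]

variable (p) in
/-- The lift of `periodMatrix` to the `p`-adic integers. -/
def padicPeriodMatrix (half : ℤ_[p]) : Matrix (Fin 2) (Fin 2) (PowerSeries ℤ_[p]) :=
  !![padicBinomSeries p half 0 0, -padicBinomSeries p half 0 1;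
    -padicBinomSeries p half 1 0, padicBinomSeries p half 1 1]

lemma map_padicPeriodMatrix {half : ℤ_[p]} (hh : 2 * half = 1) :
    (padicPeriodMatrix p half).map (PowerSeries.map (algebraMap ℤ_[p] ℚ_[p])) =
      periodMatrix ℚ_[p] := by
  ext1 i j
  rw [periodMatrix, hypT_eq_zero_zero, hypT_eq_zero_one, hypT_eq_one_zero, hypT_eq_one_one]
  fin_cases i <;> fin_cases j <;> simp [padicPeriodMatrix, map_padicBinomSeries hh]

lemma substPow_apply {R : Type*} [CommRing R] {k : ℕ} (hk : k ≠ 0)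
    (M : Matrix (Fin 2) (Fin 2) (PowerSeries R)) (i j : Fin 2) :
    substPow k M i j = PowerSeries.expand k hk (M i j) := by
  rw [substPow, Matrix.map_apply, PowerSeries.expand_apply]

/-- The constant term of the matrix is the identity. -/
lemma isUnit_substPow_padicPeriodMatrix (half : ℤ_[p]) :
    IsUnit (substPow p (padicPeriodMatrix p half)) := by
  have h : ∀ i j, PowerSeries.constantCoeff (padicBinomSeries p half i j) =
      if 2 ∣ i + j then 1 else 0 := by
    intro i j
    rw [← PowerSeries.coeff_zero_eq_constantCoeff_apply, coeff_padicBinomSeries, zero_add,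
      Ring.choose_zero_right]
  rw [Matrix.isUnit_iff_isUnit_det, Matrix.det_fin_two, PowerSeries.isUnit_iff_constantCoeff]
  simp [substPow_apply hp.out.ne_zero, padicPeriodMatrix, h]

/-- A matrix form of `padicBinomSeries_tail_congr`. -/
theorem padicPeriodMatrix_congr (h3 : 3 < p) {half : ℤ_[p]} (hh : 2 * half = 1) (s : ℕ) :
    ∃ M : Matrix (Fin 2) (Fin 2) (PowerSeries ℤ_[p]),
      (∃ E, padicPeriodMatrix p half = M * substPow p (padicPeriodMatrix p half) +
        (p : PowerSeries ℤ_[p]) ^ (s + 1) • E) ∧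
      ∀ n, p ^ s ∣ n → ∃ E, truncMatrix (p * n) (padicPeriodMatrix p half) =
        M * substPow p (truncMatrix n (padicPeriodMatrix p half)) +
          (p : PowerSeries ℤ_[p]) ^ (s + 1) • E := by
  obtain ⟨c, hc⟩ := padicBinomSeries_tail_congr h3 hh s
  have hC : PowerSeries.C ((p : ℤ_[p]) ^ (s + 1)) = (p : PowerSeries ℤ_[p]) ^ (s + 1) := by simp
  simp only [hC, Fin.sum_univ_two] at hc
  have hY : ∀ i j : Fin 2, (p : PowerSeries ℤ_[p]) ^ (s + 1) ∣ padicBinomSeries p half i j -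
      (c i 0 * PowerSeries.expand p hp.out.ne_zero (padicBinomSeries p half 0 j) +
        c i 1 * PowerSeries.expand p hp.out.ne_zero (padicBinomSeries p half 1 j)) := by
    intro i j
    -- For n = 0 nothing is cut off, so the tail congruence concerns Y itself.
    simpa [truncSeries_zero] using hc i j 0 (dvd_zero _)
  have hT : ∀ (n : ℕ), p ^ s ∣ n → ∀ (i j : Fin 2), (p : PowerSeries ℤ_[p]) ^ (s + 1) ∣
      truncSeries (p * n) (padicBinomSeries p half i j) -
      (c i 0 * PowerSeries.expand p hp.out.ne_zero
        (truncSeries n (padicBinomSeries p half 0 j)) +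
      c i 1 * PowerSeries.expand p hp.out.ne_zero
        (truncSeries n (padicBinomSeries p half 1 j))) := by
    intro n hn i j
    have := dvd_sub (hY i j) (hc i j n hn)
    simp only [map_sub, Fin.val_zero, Fin.val_one] at this
    convert this using 1
    ring
  -- The signs are conjugation by diag(1, -1), which relates Y to the matrix of binomial series.
  refine ⟨!![c 0 0, -c 0 1; -c 1 0, c 1 1], ?_, fun n hn => ?_⟩
  · choose E hE using hY
    refine ⟨!![E 0 0, -E 0 1; -E 1 0, E 1 1], ?_⟩
    ext1 i j
    simp only [Matrix.add_apply, Matrix.mul_apply, Fin.sum_univ_two,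
      substPow_apply hp.out.ne_zero, Matrix.smul_apply, smul_eq_mul]
    have h := hE i j
    fin_cases i <;> fin_cases j <;> simp [padicPeriodMatrix] at h ⊢ <;>
      first | linear_combination h | linear_combination -h
  · choose E hE using hT n hn
    refine ⟨!![E 0 0, -E 0 1; -E 1 0, E 1 1], ?_⟩
    ext1 i j
    simp only [Matrix.add_apply, Matrix.mul_apply, Fin.sum_univ_two,
      substPow_apply hp.out.ne_zero, Matrix.smul_apply, smul_eq_mul]
    have h := hE i j
    fin_cases i <;> fin_cases j <;> simp [padicPeriodMatrix, truncMatrix] at h ⊢ <;>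
      first | linear_combination h | linear_combination -h

end Assembly

end DworkMatrix

end

/-- For a prime `p > 3` the matrix `Y(t)` has entries in `ℤ_p⟦t⟧`, the matrix `Y(t ^ p)` is
invertible over `ℤ_p⟦t⟧`, and the matrix Dwork congruences hold for all `m, s ≥ 1`.
The lift `Y` of the hypergeometric matrix to `ℤ_p⟦t⟧` is unique, as `ℤ_p → ℚ_p` is injective. -/
theorem mainTheorem2 (p : ℕ) [Fact p.Prime] (hp : 3 < p) :
    ∃ Y : Matrix (Fin 2) (Fin 2) (PowerSeries ℤ_[p]),
      Y.map (PowerSeries.map (algebraMap ℤ_[p] ℚ_[p])) = DworkMatrix.periodMatrix ℚ_[p] ∧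
      IsUnit (DworkMatrix.substPow p Y) ∧
      ∀ m s : ℕ, 1 ≤ m → 1 ≤ s →
        DworkMatrix.MatrixModEq ((p : PowerSeries ℤ_[p]) ^ s)
          (DworkMatrix.truncMatrix (m * p ^ s) Y)
          ((Y * (DworkMatrix.substPow p Y)⁻¹) *
            DworkMatrix.substPow p (DworkMatrix.truncMatrix (m * p ^ (s - 1)) Y)) := by
  obtain ⟨half, hh⟩ := (DworkMatrix.isUnit_two_three hp).1.exists_right_inv
  have hu := DworkMatrix.isUnit_substPow_padicPeriodMatrix half
  refine ⟨DworkMatrix.padicPeriodMatrix p half, DworkMatrix.map_padicPeriodMatrix hh, hu, ?_⟩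
  rintro m (_ | s) - hs
  · omega
  obtain ⟨M, ⟨E, hE⟩, hT⟩ := DworkMatrix.padicPeriodMatrix_congr hp hh s
  obtain ⟨E', hE'⟩ := hT (m * p ^ s) (dvd_mul_left _ _)
  set Y := DworkMatrix.padicPeriodMatrix p half
  have hinv : DworkMatrix.substPow p Y * (DworkMatrix.substPow p Y)⁻¹ = 1 :=
    Matrix.mul_nonsing_inv _ ((Matrix.isUnit_iff_isUnit_det _).1 hu)
  -- M depends on s, but modulo p^(s+1) it agrees with the fixed matrix Y(t) Y(t^p)⁻¹.
  have hL : Y * (DworkMatrix.substPow p Y)⁻¹ =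
      M + (p : PowerSeries ℤ_[p]) ^ (s + 1) • (E * (DworkMatrix.substPow p Y)⁻¹) := by
    have h := congrArg (· * (DworkMatrix.substPow p Y)⁻¹) hE
    simpa only [add_mul, mul_assoc, hinv, mul_one, Matrix.smul_mul] using h
  intro i j
  rw [SModEq.sub_mem, Ideal.mem_span_singleton, Nat.add_sub_cancel,
    show m * p ^ (s + 1) = p * (m * p ^ s) by ring, hL, hE', ← Matrix.sub_apply, add_mul,
    add_sub_add_left_eq_sub, Matrix.smul_mul, ← smul_sub, Matrix.smul_apply, smul_eq_mul]
  exact dvd_mul_right _ _
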